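/- Write $|\cdot|$ for the Euclidean norm, $|K|:=\sup_{x\in K}|x|$ for a compact set $K\subset\mathbb{R}^n$ (with $|\emptyset|:=0$), and $$\|f\|_{C^k(\Omega)}:=\max_{|\alpha|\le k}\ \sup_{p\in\Omega}|D^\alpha f(p)|,$$ where the $D^\alpha$ are partial derivatives with respect to all variables, one-sided at boundary points of the domain on which $f$ is given. There is a function $G=G(k,d,T,R,M)>0$, nondecreasing in $M$, of integers $k,d\ge 0$ and real numbers $T,R,M$ with the following property. Let $n,D,k\ge 1$ be integers, $T>0$, and put $d:=2+n+D$. Let $V$ satisfy (H1) $V\in C^k([0,T]\times\mathbb{R}^n\times[0,1]^D;\mathbb{R}^n)$, and (H2) $|V(t,x,\eta)|\le C(1+|x|)$ for all $(t,x,\eta)\in[0,T]\times\mathbb{R}^n\times[0,1]^D$, for some constant $C>0$. Let $X$ be the characteristic flow of $V$: for $(t,x,\eta)\in[0,T]\times\mathbb{R}^n\times[0,1]^D$, the curve $s\mapsto X(s,t,x,\eta)$ solves $$\partial_sX(s,t,x,\eta)=V(s,X(s,t,x,\eta),\eta)\quad(s\in[0,T]),\qquad X(t,t,x,\eta)=x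 .$$ Such a flow exists, and every such flow belongs to $C^k([0,T]\times[0,T]\times\mathbb{R}^n\times[0,1]^D;\mathbb{R}^n)$. Moreover, for every compact $K\subset\mathbb{R}^n$, with $$G_0:=(|K|+CT)\,e^{CT},\qquad M:=\|V\|_{C^k([0,T]\times\{|x|\le G_0\}\times[0,1]^D)},$$ one has $M<\infty$ and $$\|X\|_{C^k([0,T]\times[0,T]\times K\times[0,1]^D)}\le G\bigl(k,d,T,|K|,M\bigr).$$ -/

import Mathlib

open scoped ENNReal

/-- The `C^k` norm `max_{|α| ≤ k} sup_{p ∈ Ω} |D^α f(p)|` over `Ω` of a function `f` given on a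
set `S ⊇ Ω`. The derivatives are taken within `S` (so they are one-sided at the boundary of `S`),
and the partial derivatives are those along the vectors of the basis `b`. For `f` of class `C^k`
on `S` the order of differentiation is irrelevant, so a partial derivative `D^α f` with `|α| = j`
is the `j`-th derivative applied to a list of `j` coordinate directions. -/
noncomputable def ckNorm {ι E F : Type*} [NormedAddCommGroup E] [NormedSpace ℝ E]
    [NormedAddCommGroup F] [NormedSpace ℝ F] (b : Module.Basis ι ℝ E) (k : ℕ) (S Ω : Set E)
    (f : E → F) : ℝ≥0∞ :=
  ⨆ j : ℕ, ⨆ _ : j ≤ k, ⨆ l : Fin j → ι, ⨆ p ∈ Ω,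
    ‖iteratedFDerivWithin ℝ j f S p (fun i => b (l i))‖ₑ

/-- The space of the variables `(t, x, η)`. -/
abbrev FieldVar (n D : ℕ) : Type := ℝ × EuclideanSpace ℝ (Fin n) × (Fin D → ℝ)

/-- The space of the variables `(s, t, x, η)`. -/
abbrev FlowVar (n D : ℕ) : Type := ℝ × FieldVar n D

/-- The coordinate directions of `(t, x, η)`. -/
noncomputable def fieldBasis (n D : ℕ) :
    Module.Basis (Unit ⊕ (Fin n ⊕ Fin D)) ℝ (FieldVar n D) :=
  (Module.Basis.singleton Unit ℝ).prod
    ((EuclideanSpace.basisFun (Fin n) ℝ).toBasis.prod (Pi.basisFun ℝ (Fin D)))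

/-- The coordinate directions of `(s, t, x, η)`. -/
noncomputable def flowBasis (n D : ℕ) :
    Module.Basis (Unit ⊕ (Unit ⊕ (Fin n ⊕ Fin D))) ℝ (FlowVar n D) :=
  (Module.Basis.singleton Unit ℝ).prod (fieldBasis n D)

/-- `[0,T] × A × [0,1]^D`. -/
def fieldDomain {n : ℕ} (D : ℕ) (T : ℝ) (A : Set (EuclideanSpace ℝ (Fin n))) :
    Set (FieldVar n D) :=
  Set.Icc 0 T ×ˢ A ×ˢ Set.Icc 0 1

/-- `[0,T] × [0,T] × A × [0,1]^D`. -/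
def flowDomain {n : ℕ} (D : ℕ) (T : ℝ) (A : Set (EuclideanSpace ℝ (Fin n))) :
    Set (FlowVar n D) :=
  Set.Icc 0 T ×ˢ fieldDomain D T A

/-- Linear growth: `|V(t,x,η)| ≤ C (1 + |x|)` on `[0,T] × ℝⁿ × [0,1]^D`. -/
def LinearGrowth {n D : ℕ} (T C : ℝ) (V : FieldVar n D → EuclideanSpace ℝ (Fin n)) : Prop :=
  ∀ t ∈ Set.Icc (0 : ℝ) T, ∀ x : EuclideanSpace ℝ (Fin n),
    ∀ η ∈ Set.Icc (0 : Fin D → ℝ) 1, ‖V (t, x, η)‖ ≤ C * (1 + ‖x‖)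

/-- `X` is a characteristic flow of `V`: for all `(t,x,η) ∈ [0,T] × ℝⁿ × [0,1]^D` the curve
`γ(s) = X(s,t,x,η)` solves `γ'(s) = V(s,γ(s),η)` on `[0,T]` with `γ(t) = x`. -/
def IsCharacteristicFlow {n D : ℕ} (T : ℝ) (V : FieldVar n D → EuclideanSpace ℝ (Fin n))
    (X : FlowVar n D → EuclideanSpace ℝ (Fin n)) : Prop :=
  ∀ t ∈ Set.Icc (0 : ℝ) T, ∀ x : EuclideanSpace ℝ (Fin n),
    ∀ η ∈ Set.Icc (0 : Fin D → ℝ) 1,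
      X (t, t, x, η) = x ∧
      ∀ s ∈ Set.Icc (0 : ℝ) T,
        HasDerivWithinAt (fun σ => X (σ, t, x, η)) (V (s, X (s, t, x, η), η)) (Set.Icc 0 T) s

/-- `|K| = sup_{x ∈ K} |x|`. -/
noncomputable def setRadius {n : ℕ} (K : Set (EuclideanSpace ℝ (Fin n))) : ℝ :=
  sSup ((fun x => ‖x‖) '' K)

/-- The radius `(R + C T) exp(C T)` of the ball that confines, for a field of linear growth with
constant `C`, all characteristic curves on `[0,T]` through points of norm at most `R`. -/
noncomputable def confiningRadius (T C R : ℝ) : ℝ := (R + C * T) * Real.exp (C * T)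

/-- The norm of `V` in `C^k([0,T] × B × [0,1]^D)`, where `B` is the closed ball of radius `r`
around the origin of `ℝⁿ`. -/
noncomputable def fieldCkNorm {n D : ℕ} (k : ℕ) (T r : ℝ)
    (V : FieldVar n D → EuclideanSpace ℝ (Fin n)) : ℝ≥0∞ :=
  ckNorm (fieldBasis n D) k (fieldDomain D T Set.univ)
    (fieldDomain D T (Metric.closedBall 0 r)) V

/-- The norm of `X` in `C^k([0,T] × [0,T] × K × [0,1]^D)`. -/
noncomputable def flowCkNorm {n D : ℕ} (k : ℕ) (T : ℝ) (K : Set (EuclideanSpace ℝ (Fin n)))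
    (X : FlowVar n D → EuclideanSpace ℝ (Fin n)) : ℝ≥0∞ :=
  ckNorm (flowBasis n D) k (flowDomain D T Set.univ) (flowDomain D T K) X

/-! Linear growth and Grönwall's inequality confine the curves through points of norm at most `R` to
the ball of radius `(R + CT) exp(CT)`. This yields existence on all of `[0,T]`, and it is why only
the norm of `V` on that ball enters the estimate.

For regularity, both times become parameters. With `p = (s,t,x,η)`, the displacement `Z(τ,p) =
X(t+τ(s-t),t,x,η) - x` solves `z' = (s-t) V(t+τ(s-t), x+z, η)`, `z(0) = 0`, on the fixed interval
`[0,1]`, and `X(p) = x + Z(1,p)`. All partial derivatives of `X`, those in `s` and `t` included, are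
thus parameter derivatives at the fixed time `1`.

Parametric solutions are treated by induction on `k` in `parametricSolution_regularity`. The
derivative `A = D_p Z` solves the linear variational equation (`exists_variation`,
`hasFDerivWithinAt_of_variation`), so `(Z,A)` is a parametric solution for `variationField`, which
has one derivative less than `F`. The Leibniz rule and Grönwall bound that field along the
trajectory, which gives the recursion `solutionBound`.

The constant may depend neither on `C` nor on `V`. `exists_bound_flowCkNorm` provides one depending
on `n, D, k, T, R, M` only, and a finite sum of such constants is `G`. -/

open Set Metric Filter Topology
open scoped NNReal

universe u

/-! ### Grönwall's inequality on the unit interval -/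

section Gronwall

variable {E : Type*} [NormedAddCommGroup E] [NormedSpace ℝ E]

theorem norm_le_of_norm_deriv_le_mul_add {u v : ℝ → E} {K ε : ℝ} (hK : 0 ≤ K) (hε : 0 ≤ ε)
    (hu : ∀ τ ∈ Icc (0 : ℝ) 1, HasDerivWithinAt u (v τ) (Icc 0 1) τ)
    (hv : ∀ τ ∈ Icc (0 : ℝ) 1, ‖v τ‖ ≤ K * ‖u τ‖ + ε) :
    ∀ τ ∈ Icc (0 : ℝ) 1, ‖u τ‖ ≤ (‖u 0‖ + ε) * Real.exp K := by
  intro τ hτ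
  have h1 := norm_le_gronwallBound_of_norm_deriv_right_le (f := u) (f' := v) (K := K) (ε := ε)
    (a := 0) (b := 1) (HasDerivWithinAt.continuousOn hu)
    (fun x hx => (hu x (Ico_subset_Icc_self hx)).mono_of_mem_nhdsWithin
      (Icc_mem_nhdsGE_of_mem hx)) le_rfl
    (fun x hx => hv x (Ico_subset_Icc_self hx)) τ hτ
  have h2 : gronwallBound ‖u 0‖ K ε (τ - 0) ≤ gronwallBound ‖u 0‖ K ε 1 :=
    gronwallBound_mono (norm_nonneg _) hε hK (by simpa using hτ.2)
  refine h1.trans (h2.trans ?_)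
  rcases hK.eq_or_lt with rfl | hK
  · simp [gronwallBound_K0]
  · rw [gronwallBound_of_K_ne_0 hK.ne']
    simp only [mul_one, add_mul]
    refine add_le_add le_rfl ?_
    -- What remains is `exp K - 1 ≤ K exp K`, that is, `1 - K ≤ exp (-K)` multiplied by `exp K`.
    rw [div_mul_eq_mul_div, div_le_iff₀ hK, mul_assoc]
    refine mul_le_mul_of_nonneg_left ?_ hε
    have h3 := Real.add_one_le_exp (-K)
    have h4 : Real.exp K * Real.exp (-K) = 1 := by rw [← Real.exp_add]; simp
    nlinarith [Real.exp_pos K]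

end Gronwall

/-! ### Radial truncation -/

section Retraction

variable {E : Type*} [NormedAddCommGroup E] [NormedSpace ℝ E]

/-- The radial retraction of a normed space onto the closed ball of radius `R`. -/
noncomputable def radialRetraction (R : ℝ) (x : E) : E := (R / max R ‖x‖) • x

theorem radialRetraction_of_norm_le {R : ℝ} (hR : 0 < R) {x : E} (hx : ‖x‖ ≤ R) :
    radialRetraction R x = x := by
  rw [radialRetraction, max_eq_left hx, div_self hR.ne', one_smul]

theorem norm_radialRetraction_le {R : ℝ} (hR : 0 < R) (x : E) :
    ‖radialRetraction R x‖ ≤ R := by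
  have h : 0 < max R ‖x‖ := lt_max_of_lt_left hR
  rw [radialRetraction, norm_smul, Real.norm_of_nonneg (by positivity), div_mul_eq_mul_div,
    div_le_iff₀ h]
  gcongr
  exact le_max_right _ _

theorem norm_radialRetraction_le_norm {R : ℝ} (hR : 0 < R) (x : E) :
    ‖radialRetraction R x‖ ≤ ‖x‖ := by
  have h : 0 < max R ‖x‖ := lt_max_of_lt_left hR
  rw [radialRetraction, norm_smul, Real.norm_of_nonneg (by positivity)]
  exact mul_le_of_le_one_left (norm_nonneg _) ((div_le_one h).2 (le_max_left _ _))

/-- Moving the point and moving the scaling factor each cost at most `‖x - y‖`. No inner product is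
available, since the retraction is also used on spaces of linear maps. -/
theorem lipschitzWith_radialRetraction {R : ℝ} (hR : 0 < R) :
    LipschitzWith 2 (radialRetraction R : E → E) := by
  refine LipschitzWith.of_dist_le_mul fun x y => ?_
  rw [dist_eq_norm, dist_eq_norm]
  have hx : 0 < max R ‖x‖ := lt_max_of_lt_left hR
  have hy : 0 < max R ‖y‖ := lt_max_of_lt_left hR
  have h1 : radialRetraction R x - radialRetraction R y =
      (R / max R ‖x‖) • (x - y) + (R / max R ‖x‖ - R / max R ‖y‖) • y := by
    simp only [radialRetraction, smul_sub, sub_smul]; abel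
  have h2 : |R / max R ‖x‖ - R / max R ‖y‖| =
      R / max R ‖x‖ * (|max R ‖y‖ - max R ‖x‖| / max R ‖y‖) := by
    rw [← abs_of_pos hy, ← abs_div, ← abs_of_pos (div_pos hR hx), ← abs_mul, abs_of_pos hy,
      abs_of_pos (div_pos hR hx)]
    congr 1
    field_simp
  have h3 : |max R ‖y‖ - max R ‖x‖| ≤ ‖x - y‖ := by
    refine (abs_max_sub_max_le_max R ‖y‖ R ‖x‖).trans ?_
    rw [sub_self, abs_zero, max_eq_right (abs_nonneg _), norm_sub_rev]
    exact abs_norm_sub_norm_le y x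
  have h4 : R / max R ‖x‖ ≤ 1 := (div_le_one hx).2 (le_max_left _ _)
  rw [h1]
  refine (norm_add_le _ _).trans ?_
  rw [norm_smul, norm_smul, Real.norm_eq_abs, Real.norm_eq_abs, h2, abs_of_pos (div_pos hR hx)]
  have h5 : |max R ‖y‖ - max R ‖x‖| / max R ‖y‖ * ‖y‖ ≤ ‖x - y‖ := by
    rw [div_mul_eq_mul_div, div_le_iff₀ hy]
    gcongr
    exact le_max_right _ _
  have h6 : R / max R ‖x‖ * (|max R ‖y‖ - max R ‖x‖| / max R ‖y‖) * ‖y‖ ≤ 1 * ‖x - y‖ := by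
    rw [mul_assoc]
    gcongr
  have h7 : R / max R ‖x‖ * ‖x - y‖ ≤ 1 * ‖x - y‖ := by gcongr
  rw [NNReal.coe_ofNat]
  linarith

end Retraction

/-! ### Confinement and global existence -/

section Existence

variable {E : Type*} [NormedAddCommGroup E] [NormedSpace ℝ E]

/-- The restriction of a curve to the segment from `t` to `s`, run through in unit time. -/
theorem hasDerivWithinAt_segment {u v : ℝ → E} {a b t s : ℝ} (ht : t ∈ Icc a b)
    (hs : s ∈ Icc a b) (hu : ∀ σ ∈ Icc a b, HasDerivWithinAt u (v σ) (Icc a b) σ)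
    {τ : ℝ} (hτ : τ ∈ Icc (0 : ℝ) 1) :
    HasDerivWithinAt (fun τ => u (t + τ * (s - t))) ((s - t) • v (t + τ * (s - t)))
      (Icc 0 1) τ := by
  have hm : MapsTo (fun τ : ℝ => t + τ * (s - t)) (Icc 0 1) (Icc a b) := fun τ hτ => by
    have := (convex_Icc a b).add_smul_sub_mem ht hs hτ
    simpa using this
  have h : HasDerivWithinAt (fun τ : ℝ => t + τ * (s - t)) (s - t) (Icc 0 1) τ := by
    simpa using (((hasDerivAt_id τ).mul_const (s - t)).const_add t).hasDerivWithinAt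
  exact (hu _ (hm hτ)).scomp τ h hm

/-- Running through the segment from `t` to `s` in unit time treats forward and backward evolution
alike; the speed gains a factor `|s - t| ≤ b - a`. -/
theorem norm_le_of_norm_deriv_le_growth {u v : ℝ → E} {a b t s C : ℝ} (hC : 0 ≤ C)
    (ht : t ∈ Icc a b) (hs : s ∈ Icc a b)
    (hu : ∀ σ ∈ Icc a b, HasDerivWithinAt u (v σ) (Icc a b) σ)
    (hv : ∀ σ ∈ Icc a b, ‖v σ‖ ≤ C * (1 + ‖u σ‖)) :
    ‖u s‖ ≤ (‖u t‖ + C * (b - a)) * Real.exp (C * (b - a)) := by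
  have hst : |s - t| ≤ b - a := abs_sub_le_of_le_of_le hs.1 hs.2 ht.1 ht.2
  have hm : ∀ τ ∈ Icc (0 : ℝ) 1, t + τ * (s - t) ∈ Icc a b := fun τ hτ => by
    simpa using (convex_Icc a b).add_smul_sub_mem ht hs hτ
  have hba : 0 ≤ C * (b - a) := mul_nonneg hC ((abs_nonneg _).trans hst)
  have := norm_le_of_norm_deriv_le_mul_add (u := fun τ => u (t + τ * (s - t))) hba hba
    (fun τ hτ => hasDerivWithinAt_segment ht hs hu hτ) (fun τ hτ => ?_) 1 (by simp)
  · simpa using this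
  · rw [norm_smul, Real.norm_eq_abs]
    have h1 := hv _ (hm τ hτ)
    have h2 : |s - t| * ‖v (t + τ * (s - t))‖ ≤ (b - a) * (C * (1 + ‖u (t + τ * (s - t))‖)) := by
      gcongr
      exact (abs_nonneg _).trans hst
    linarith

/-- Global existence for a locally Lipschitz field of linear growth. -/
theorem exists_solution_of_linear_growth [CompleteSpace E] {f : ℝ → E → E} {a b t C : ℝ}
    (ht : t ∈ Icc a b) (hC : 0 ≤ C)
    (hlip : ∀ R : ℝ, ∃ K : ℝ≥0, ∀ σ ∈ Icc a b, LipschitzOnWith K (f σ) (closedBall 0 R))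
    (hcont : ∀ x, ContinuousOn (fun σ => f σ x) (Icc a b))
    (hgrowth : ∀ σ ∈ Icc a b, ∀ x, ‖f σ x‖ ≤ C * (1 + ‖x‖)) (x : E) :
    ∃ u : ℝ → E, u t = x ∧
      ∀ σ ∈ Icc a b, HasDerivWithinAt u (f σ (u σ)) (Icc a b) σ := by
  have hab : 0 ≤ b - a := by linarith [ht.1, ht.2]
  -- This is the a priori bound for solutions, plus `1` so that `R > 0`. The field truncated at
  -- radius `R` has the same growth, so its solution stays where the truncation is the identity.
  set R : ℝ := (‖x‖ + C * (b - a)) * Real.exp (C * (b - a)) + 1 with hRdef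
  have hR : 0 < R := by positivity
  obtain ⟨K, hK⟩ := hlip R
  have hmem : ∀ y : E, radialRetraction R y ∈ closedBall (0 : E) R := fun y => by
    simpa using norm_radialRetraction_le hR y
  -- The truncated field is globally bounded by `C (1 + R)`. A ball of radius speed times length of
  -- the interval makes the Picard–Lindelöf solution live on all of `[a,b]`.
  have hpl : IsPicardLindelof (fun σ y => f σ (radialRetraction R y)) (⟨t, ht⟩ : Icc a b) x
      (Real.toNNReal (C * (1 + R) * (b - a))) 0 (Real.toNNReal (C * (1 + R))) (K * 2) := by
    refine ⟨fun σ hσ => ?_, fun y _ => hcont _, fun σ hσ y _ => ?_, ?_⟩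
    · exact (hK σ hσ).comp (lipschitzWith_radialRetraction hR).lipschitzOnWith
        (fun y _ => hmem y)
    · rw [Real.coe_toNNReal _ (by positivity)]
      refine (hgrowth σ hσ _).trans ?_
      gcongr
      exact norm_radialRetraction_le hR y
    · rw [Real.coe_toNNReal _ (by positivity), Real.coe_toNNReal _ (by positivity)]
      simp only [NNReal.coe_zero, sub_zero]
      gcongr
      exact max_le (by linarith [ht.1]) (by linarith [ht.2])
  obtain ⟨u, hut, hu⟩ := hpl.exists_eq_forall_mem_Icc_hasDerivWithinAt₀
  refine ⟨u, hut, fun σ hσ => ?_⟩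
  have hb : ‖u σ‖ ≤ R := by
    have := norm_le_of_norm_deriv_le_growth hC ht hσ hu (fun ρ hρ => (hgrowth ρ hρ _).trans (by
      gcongr
      exact norm_radialRetraction_le_norm hR _))
    simp only at hut
    rw [hut] at this
    linarith
  simpa [radialRetraction_of_norm_le hR hb] using hu σ hσ

end Existence

/-! ### Continuity and first derivative in the parameter -/

section ParametricSolution

variable {E P : Type*} [NormedAddCommGroup E] [NormedSpace ℝ E]
  [NormedAddCommGroup P] [NormedSpace ℝ P]

/-- The domain `[0,1] × E × Q` of the fields with parameters in `Q`. -/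
def paramDomain (E : Type*) {P : Type*} (Q : Set P) : Set (ℝ × E × P) :=
  Icc 0 1 ×ˢ univ ×ˢ Q

/-- For each parameter `p ∈ Q`, the curve `Z (·, p)` solves `z' = F (τ, z, p)` on `[0,1]` with
`z(0) = 0`. -/
def IsParametricSolution (Q : Set P) (F : ℝ × E × P → E) (Z : ℝ × P → E) : Prop :=
  ∀ p ∈ Q, Z (0, p) = 0 ∧ ∀ τ ∈ Icc (0 : ℝ) 1,
    HasDerivWithinAt (fun σ => Z (σ, p)) (F (τ, Z (τ, p), p)) (Icc 0 1) τ

theorem uniqueDiffOn_paramDomain {Q : Set P} (hQ : UniqueDiffOn ℝ Q) :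
    UniqueDiffOn ℝ (paramDomain E Q) :=
  (uniqueDiffOn_Icc zero_lt_one).prod (uniqueDiffOn_univ.prod hQ)

/-- The direction `(0, A h, h)` of the variation of `(τ, z, p)` under a variation `h` of `p`. -/
noncomputable def graphDirection (A : P →L[ℝ] E) : P →L[ℝ] ℝ × E × P :=
  (0 : P →L[ℝ] ℝ).prod (A.prod (ContinuousLinearMap.id ℝ P))

theorem graphDirection_eq (A : P →L[ℝ] E) :
    graphDirection A = ((ContinuousLinearMap.inr ℝ ℝ (E × P)).comp
      (ContinuousLinearMap.inl ℝ E P)).comp A +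
      (ContinuousLinearMap.inr ℝ ℝ (E × P)).comp (ContinuousLinearMap.inr ℝ E P) := by
  ext <;> simp [graphDirection]

theorem norm_graphDirection_le (A : P →L[ℝ] E) : ‖graphDirection A‖ ≤ ‖A‖ + 1 := by
  refine ContinuousLinearMap.opNorm_le_bound _ (by positivity) fun h => ?_
  have h1 := A.le_opNorm h
  have h2 : 0 ≤ ‖A‖ * ‖h‖ := by positivity
  simp only [graphDirection, ContinuousLinearMap.prod_apply, Prod.norm_def,
    zero_apply, norm_zero, ContinuousLinearMap.id_apply]
  refine max_le (by positivity) (max_le ?_ ?_) <;> nlinarith [norm_nonneg h]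

theorem norm_graphDirection_sub_le (A B : P →L[ℝ] E) :
    ‖graphDirection A - graphDirection B‖ ≤ ‖A - B‖ := by
  refine ContinuousLinearMap.opNorm_le_bound _ (by positivity) fun h => ?_
  have h1 := (A - B).le_opNorm h
  simpa [graphDirection, Prod.norm_def] using h1

/-- The field whose parametric solutions are the pairs of a parametric solution for `F` and of its
derivative with respect to the parameter. -/
noncomputable def variationField (Q : Set P) (F : ℝ × E × P → E) :
    ℝ × (E × (P →L[ℝ] E)) × P → E × (P →L[ℝ] E) := fun q =>
  (F (q.1, q.2.1.1, q.2.2),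
    (fderivWithin ℝ F (paramDomain E Q) (q.1, q.2.1.1, q.2.2)).comp (graphDirection q.2.1.2))

/-- Tube lemma: compactness of `k` makes continuity in the parameter uniform over `k`. -/
theorem eventually_dist_lt_of_continuousOn {α β G : Type*} [TopologicalSpace α]
    [TopologicalSpace β] [PseudoMetricSpace G] {f : β × α → G} {s : Set α} {k : Set β}
    (hk : IsCompact k) (hf : ContinuousOn f (k ×ˢ s)) {q : α} (hq : q ∈ s) {ε : ℝ} (hε : 0 < ε) :
    ∀ᶠ p in 𝓝[s] q, ∀ x ∈ k, dist (f (x, p)) (f (x, q)) < ε := by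
  obtain ⟨v, hv, h⟩ := hk.mem_uniformity_of_prod (f := fun p x => f (x, p)) (s := s)
    (hf.comp continuous_swap.continuousOn fun y hy => ⟨hy.2, hy.1⟩) hq (dist_mem_uniformity hε)
  filter_upwards [hv] with p hp using h p hp

omit [NormedSpace ℝ P] in
-- The difference of two curves starts at `0`, so Grönwall makes it small uniformly in `τ`;
-- continuity in `τ` of the single curve does the rest. It serves both for `Z` and for its variation
-- `A`.
theorem continuousOn_of_norm_deriv_sub_le {Q : Set P} {u v : ℝ × P → E}
    (h0 : ∀ p ∈ Q, u (0, p) = 0)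
    (hu : ∀ p ∈ Q, ∀ τ ∈ Icc (0 : ℝ) 1,
      HasDerivWithinAt (fun σ => u (σ, p)) (v (τ, p)) (Icc 0 1) τ)
    (hv : ∀ p ∈ Q, ∃ K : ℝ, 0 ≤ K ∧ ∀ ε > (0 : ℝ), ∀ᶠ p' in 𝓝[Q] p, ∀ τ ∈ Icc (0 : ℝ) 1,
      ‖v (τ, p') - v (τ, p)‖ ≤ K * ‖u (τ, p') - u (τ, p)‖ + ε) :
    ContinuousOn u (Icc 0 1 ×ˢ Q) := by
  rintro ⟨τ, p⟩ ⟨hτ, hp⟩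
  rw [ContinuousWithinAt, Metric.tendsto_nhds]
  intro ε hε
  obtain ⟨K, hK, hKε⟩ := hv p hp
  have hδ : 0 < ε / 2 / Real.exp K := by positivity
  have h1 : ∀ᶠ σ in 𝓝[Icc 0 1] τ, dist (u (σ, p)) (u (τ, p)) < ε / 2 :=
    Metric.tendsto_nhds.1 (hu p hp τ hτ).continuousWithinAt _ (half_pos hε)
  have h2 : ∀ᶠ p' in 𝓝[Q] p, p' ∈ Q := self_mem_nhdsWithin
  have h3 : ∀ᶠ σ in 𝓝[Icc (0 : ℝ) 1] τ, σ ∈ Icc (0 : ℝ) 1 := self_mem_nhdsWithin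
  rw [nhdsWithin_prod_eq]
  filter_upwards [(h1.and h3).prod_mk ((hKε _ hδ).and h2)] with ⟨σ, p'⟩ ⟨⟨h4, h5⟩, h6, h7⟩
  have h8 := norm_le_of_norm_deriv_le_mul_add (u := fun τ => u (τ, p') - u (τ, p)) hK hδ.le
    (fun τ hτ => (hu p' h7 τ hτ).sub (hu p hp τ hτ)) h6 σ h5
  simp only [h0 p' h7, h0 p hp, sub_zero, norm_zero, zero_add] at h8
  rw [div_mul_cancel₀ _ (Real.exp_pos K).ne', ← dist_eq_norm] at h8
  linarith [dist_triangle (u (σ, p')) (u (σ, p)) (u (τ, p))]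

variable {Q : Set P} {F : ℝ × E × P → E} {Z : ℝ × P → E}

omit [NormedSpace ℝ E] [NormedSpace ℝ P] in
theorem continuousOn_trajectory (hZ : ContinuousOn Z (Icc 0 1 ×ˢ Q)) :
    ContinuousOn (fun y : ℝ × P => (y.1, Z y, y.2)) (Icc 0 1 ×ˢ Q) :=
  continuous_fst.continuousOn.prodMk (hZ.prodMk continuous_snd.continuousOn)

/-- For each parameter, the variational equation is affine in `A` with coefficient bounded along the
trajectory, so it has linear growth and a global solution. Its coefficient varies continuously with
the parameter, uniformly in time, and so does `A`. -/
theorem exists_variation [CompleteSpace E] (hQu : UniqueDiffOn ℝ Q)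
    (hF : ContDiffOn ℝ 1 F (paramDomain E Q)) (hZ : ContinuousOn Z (Icc 0 1 ×ˢ Q))
    (hsol : IsParametricSolution Q F Z) :
    ∃ A : ℝ × P → P →L[ℝ] E, ContinuousOn A (Icc 0 1 ×ˢ Q) ∧
      IsParametricSolution Q (variationField Q F) (fun y => (Z y, A y)) := by
  have hDF : ContinuousOn (fderivWithin ℝ F (paramDomain E Q)) (paramDomain E Q) :=
    hF.continuousOn_fderivWithin (uniqueDiffOn_paramDomain hQu) le_rfl
  set L : ℝ × P → ℝ × E × P →L[ℝ] E := fun y =>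
    fderivWithin ℝ F (paramDomain E Q) (y.1, Z y, y.2) with hLdef
  have hL : ContinuousOn L (Icc 0 1 ×ˢ Q) :=
    hDF.comp (continuousOn_trajectory hZ) fun y hy => ⟨hy.1, mem_univ _, hy.2⟩
  have hLp : ∀ p ∈ Q, ContinuousOn (fun τ => L (τ, p)) (Icc 0 1) := fun p hp =>
    hL.comp (by fun_prop) fun τ hτ => ⟨hτ, hp⟩
  have hβ : ∀ p ∈ Q, ∃ β : ℝ, 0 ≤ β ∧ ∀ τ ∈ Icc (0 : ℝ) 1, ‖L (τ, p)‖ ≤ β := fun p hp => by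
    obtain ⟨β, hβ⟩ := isCompact_Icc.exists_bound_of_continuousOn (hLp p hp)
    exact ⟨max β 0, le_max_right _ _, fun τ hτ => (hβ τ hτ).trans (le_max_left _ _)⟩
  have hex : ∀ p : P, ∃ u : ℝ → P →L[ℝ] E, p ∈ Q → u 0 = 0 ∧ ∀ τ ∈ Icc (0 : ℝ) 1,
      HasDerivWithinAt u ((L (τ, p)).comp (graphDirection (u τ))) (Icc 0 1) τ := by
    intro p
    by_cases hp : p ∈ Q
    · obtain ⟨β, hβ0, hβ⟩ := hβ p hp
      obtain ⟨u, h1, h2⟩ := exists_solution_of_linear_growth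
        (f := fun τ (A : P →L[ℝ] E) => (L (τ, p)).comp (graphDirection A)) (a := 0) (b := 1)
        (t := 0) (C := β) (by simp) hβ0
        (fun R => ⟨β.toNNReal, fun τ hτ => (LipschitzWith.of_dist_le_mul fun A B => by
          rw [dist_eq_norm, dist_eq_norm, ← ContinuousLinearMap.comp_sub, Real.coe_toNNReal _ hβ0]
          refine (ContinuousLinearMap.opNorm_comp_le _ _).trans ?_
          gcongr
          exacts [hβ τ hτ, norm_graphDirection_sub_le A B]).lipschitzOnWith⟩)
        (fun A => (hLp p hp).clm_comp continuousOn_const)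
        (fun τ hτ A => by
          refine (ContinuousLinearMap.opNorm_comp_le _ _).trans ?_
          gcongr
          exacts [hβ τ hτ, (norm_graphDirection_le A).trans (add_comm _ _).le])
        0
      exact ⟨u, fun _ => ⟨h1, h2⟩⟩
    · exact ⟨0, fun h => absurd h hp⟩
  choose A hA using hex
  refine ⟨fun y => A y.2 y.1, ?_, fun p hp => ⟨?_, fun τ hτ => ?_⟩⟩
  · refine continuousOn_of_norm_deriv_sub_le (fun p hp => (hA p hp).1)
      (v := fun y => (L y).comp (graphDirection (A y.2 y.1))) (fun p hp => (hA p hp).2)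
      fun p hp => ?_
    obtain ⟨β, hβ0, hβ⟩ := hβ p hp
    obtain ⟨α, hα⟩ := isCompact_Icc.exists_bound_of_continuousOn
      (HasDerivWithinAt.continuousOn (hA p hp).2)
    have hα0 : 0 ≤ α := (norm_nonneg _).trans (hα 0 (by simp))
    -- For `p'` near `p` the coefficient is within `1` of one bounded by `β`. The other tolerance `ε
    -- / (α + 1)` absorbs the norm of `graphDirection (A p τ)`.
    refine ⟨β + 1, by positivity, fun ε hε => ?_⟩
    filter_upwards [eventually_dist_lt_of_continuousOn isCompact_Icc hL hp zero_lt_one,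
      eventually_dist_lt_of_continuousOn isCompact_Icc hL hp
        (show 0 < ε / (α + 1) by positivity)] with p' h1 h2 τ hτ
    have h3 : (L (τ, p')).comp (graphDirection (A p' τ)) -
        (L (τ, p)).comp (graphDirection (A p τ)) =
        (L (τ, p')).comp (graphDirection (A p' τ) - graphDirection (A p τ)) +
        (L (τ, p') - L (τ, p)).comp (graphDirection (A p τ)) := by
      rw [ContinuousLinearMap.comp_sub, ContinuousLinearMap.sub_comp]; abel
    have h4 : ‖L (τ, p')‖ ≤ β + 1 := by
      have := h1 τ hτ
      rw [dist_eq_norm] at this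
      linarith [norm_le_norm_sub_add (L (τ, p')) (L (τ, p)), hβ τ hτ]
    have h5 := h2 τ hτ
    rw [dist_eq_norm] at h5
    rw [h3]
    refine (norm_add_le _ _).trans (add_le_add ?_ ?_)
    · refine (ContinuousLinearMap.opNorm_comp_le _ _).trans ?_
      gcongr
      exact norm_graphDirection_sub_le _ _
    · refine (ContinuousLinearMap.opNorm_comp_le _ _).trans ?_
      calc ‖L (τ, p') - L (τ, p)‖ * ‖graphDirection (A p τ)‖
          ≤ ε / (α + 1) * (α + 1) := by
            gcongr
            exact (norm_graphDirection_le _).trans (by linarith [hα τ hτ])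
        _ = ε := div_mul_cancel₀ _ (by positivity)
  · simp [(hsol p hp).1, (hA p hp).1]
  · exact ((hsol p hp).2 τ hτ).prodMk ((hA p hp).2 τ hτ)

/-- The error `W = Z(τ,p') - Z(τ,p) - A(p'-p)` vanishes at `τ = 0`, and its derivative is `L(0,W,0)`
plus the Taylor remainder of `F`. The mean value inequality, which needs `Q` convex, makes that
remainder `o(‖W‖ + ‖p'-p‖)`, and Grönwall gives `W = o(‖p'-p‖)`. -/
theorem hasFDerivWithinAt_of_variation (hQc : Convex ℝ Q) (hQu : UniqueDiffOn ℝ Q)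
    (hF : ContDiffOn ℝ 1 F (paramDomain E Q)) (hZ : ContinuousOn Z (Icc 0 1 ×ˢ Q))
    {A : ℝ × P → P →L[ℝ] E}
    (hsol : IsParametricSolution Q (variationField Q F) (fun y => (Z y, A y)))
    {τ : ℝ} (hτ : τ ∈ Icc (0 : ℝ) 1) {p : P} (hp : p ∈ Q) :
    HasFDerivWithinAt (fun p => Z (τ, p)) (A (τ, p)) Q p := by
  have hDF : ContinuousOn (fderivWithin ℝ F (paramDomain E Q)) (paramDomain E Q) :=
    hF.continuousOn_fderivWithin (uniqueDiffOn_paramDomain hQu) le_rfl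
  have hZ0 : ∀ p ∈ Q, Z (0, p) = 0 := fun p hp => congrArg Prod.fst (hsol p hp).1
  have hA0 : A (0, p) = 0 := congrArg Prod.snd (hsol p hp).1
  have hZd : ∀ p ∈ Q, ∀ τ ∈ Icc (0 : ℝ) 1,
      HasDerivWithinAt (fun σ => Z (σ, p)) (F (τ, Z (τ, p), p)) (Icc 0 1) τ := fun p hp τ hτ =>
    ((hsol p hp).2 τ hτ).fst
  have hAd : ∀ τ ∈ Icc (0 : ℝ) 1, HasDerivWithinAt (fun σ => A (σ, p))
      ((fderivWithin ℝ F (paramDomain E Q) (τ, Z (τ, p), p)).comp (graphDirection (A (τ, p))))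
      (Icc 0 1) τ := fun τ hτ => ((hsol p hp).2 τ hτ).snd
  set L : ℝ → ℝ × E × P →L[ℝ] E := fun τ =>
    fderivWithin ℝ F (paramDomain E Q) (τ, Z (τ, p), p) with hLdef
  have hZp : ContinuousOn (fun τ => Z (τ, p)) (Icc 0 1) := HasDerivWithinAt.continuousOn (hZd p hp)
  have hL : ContinuousOn L (Icc 0 1) :=
    hDF.comp (continuousOn_id.prodMk (hZp.prodMk continuousOn_const))
      fun τ hτ => ⟨hτ, mem_univ _, hp⟩
  obtain ⟨β, hβ⟩ := isCompact_Icc.exists_bound_of_continuousOn hL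
  have hβ0 : 0 ≤ β := (norm_nonneg _).trans (hβ 0 (by simp))
  obtain ⟨α, hα⟩ := isCompact_Icc.exists_bound_of_continuousOn
    (HasDerivWithinAt.continuousOn hAd)
  have hα0 : 0 ≤ α := (norm_nonneg _).trans (hα 0 (by simp))
  rw [hasFDerivWithinAt_iff_isLittleO, Asymptotics.isLittleO_iff]
  intro c hc
  -- The bound `ε ≤ 1` keeps the Grönwall rate below `β + 1`; the other entry makes the resulting
  -- factor `ε (α + 1) exp(β + 1)` at most `c`.
  set ε : ℝ := min 1 (c / ((α + 1) * Real.exp (β + 1))) with hεdef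
  have hε : 0 < ε := lt_min one_pos (by positivity)
  have hε1 : ε ≤ 1 := min_le_left _ _
  have hεc : ε * (α + 1) * Real.exp (β + 1) ≤ c := by
    rw [mul_assoc, ← le_div_iff₀ (by positivity)]
    exact min_le_right _ _
  have hnear : ∀ᶠ w in 𝓝[univ ×ˢ Q] ((0 : E), p), ∀ τ ∈ Icc (0 : ℝ) 1,
      dist (fderivWithin ℝ F (paramDomain E Q) (τ, Z (τ, p) + w.1, w.2)) (L τ) < ε := by
    have := eventually_dist_lt_of_continuousOn (s := (univ : Set E) ×ˢ Q) (q := (0, p))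
      (f := fun y : ℝ × E × P =>
        fderivWithin ℝ F (paramDomain E Q) (y.1, Z (y.1, p) + y.2.1, y.2.2))
      (isCompact_Icc (a := (0 : ℝ)) (b := 1))
      (hDF.comp (continuous_fst.continuousOn.prodMk
        (((hZp.comp continuous_fst.continuousOn fun y hy => hy.1).add (by fun_prop)).prodMk
          (by fun_prop))) fun y hy => ⟨hy.1, mem_univ _, hy.2.2⟩) ⟨mem_univ _, hp⟩ hε
    simpa using this
  obtain ⟨δ, hδ, hball⟩ := Metric.mem_nhdsWithin_iff.1 hnear
  filter_upwards [eventually_dist_lt_of_continuousOn isCompact_Icc hZ hp hδ,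
    mem_nhdsWithin_of_mem_nhds (ball_mem_nhds p hδ), self_mem_nhdsWithin] with p' h1 h2 h3
  have hmv : ∀ τ ∈ Icc (0 : ℝ) 1,
      ‖F (τ, Z (τ, p'), p') - F (τ, Z (τ, p), p) - L τ (0, Z (τ, p') - Z (τ, p), p' - p)‖ ≤
        ε * (‖Z (τ, p') - Z (τ, p)‖ + ‖p' - p‖) := by
    intro τ hτ
    -- Both points share the time `τ`, so a convex time slice suffices; on it the derivative of `F`
    -- is within `ε` of `L τ`.
    set S : Set (ℝ × E × P) := {τ} ×ˢ (ball (Z (τ, p), p) δ ∩ univ ×ˢ Q) with hS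
    have hSc : Convex ℝ S :=
      (convex_singleton τ).prod ((convex_ball _ _).inter (convex_univ.prod hQc))
    have hSsub : S ⊆ paramDomain E Q := by
      rintro ⟨σ, z, r⟩ ⟨h4, h5, h6⟩
      rw [mem_singleton_iff] at h4
      exact ⟨h4 ▸ hτ, h6⟩
    have key := hSc.norm_image_sub_le_of_norm_hasFDerivWithin_le' (f := F) (C := ε) (φ := L τ)
      (x := (τ, Z (τ, p), p)) (y := (τ, Z (τ, p'), p'))
      (fun x hx => ((hF.differentiableOn one_ne_zero x (hSsub hx)).hasFDerivWithinAt).mono hSsub)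
      ?_ ⟨rfl, mem_ball_self hδ, mem_univ _, hp⟩ ⟨rfl, ?_, mem_univ _, h3⟩
    · rw [Prod.mk_sub_mk, Prod.mk_sub_mk, sub_self] at key
      refine key.trans (mul_le_mul_of_nonneg_left ?_ hε.le)
      simp only [Prod.norm_mk, norm_zero]
      refine max_le (by positivity) (max_le ?_ ?_) <;>
        linarith [norm_nonneg (Z (τ, p') - Z (τ, p)), norm_nonneg (p' - p)]
    · rintro ⟨σ, z, r⟩ ⟨h4, h5, h6⟩
      rw [mem_singleton_iff] at h4
      dsimp only at h4
      subst h4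
      have h7 := hball (a := (z - Z (σ, p), r)) ⟨?_, mem_univ _, h6.2⟩ σ hτ
      · rw [← dist_eq_norm]
        simpa using h7.le
      · rw [mem_ball, Prod.dist_eq] at h5 ⊢
        simpa [dist_eq_norm] using h5
    · rw [mem_ball, Prod.dist_eq]
      exact max_lt (h1 τ hτ) h2
  have hgr := norm_le_of_norm_deriv_le_mul_add
    (u := fun τ => Z (τ, p') - Z (τ, p) - A (τ, p) (p' - p)) (K := β + 1)
    (ε := ε * ((α + 1) * ‖p' - p‖)) (by positivity) (by positivity)
    (fun τ hτ => ((hZd p' h3 τ hτ).sub (hZd p hp τ hτ)).sub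
      ((hAd τ hτ).clm_apply (hasDerivWithinAt_const _ _ (p' - p)))) (fun τ hτ => ?_) τ hτ
  · simp only [hZ0 p' h3, hZ0 p hp, hA0, zero_apply, sub_zero, norm_zero,
      zero_add] at hgr
    refine hgr.trans ?_
    calc ε * ((α + 1) * ‖p' - p‖) * Real.exp (β + 1)
        = (ε * (α + 1) * Real.exp (β + 1)) * ‖p' - p‖ := by ring
      _ ≤ c * ‖p' - p‖ := by gcongr
  · simp only [map_zero, add_zero, ContinuousLinearMap.comp_apply]
    set W : E := Z (τ, p') - Z (τ, p) - A (τ, p) (p' - p) with hW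
    have h4 : graphDirection (A (τ, p)) (p' - p) =
        (0, Z (τ, p') - Z (τ, p), p' - p) - ((0 : ℝ), W, (0 : P)) := by
      simp [graphDirection, hW]
    have h5 : F (τ, Z (τ, p'), p') - F (τ, Z (τ, p), p) -
        L τ (graphDirection (A (τ, p)) (p' - p)) =
        (F (τ, Z (τ, p'), p') - F (τ, Z (τ, p), p) -
          L τ (0, Z (τ, p') - Z (τ, p), p' - p)) + L τ (0, W, 0) := by
      rw [h4, map_sub]; abel
    have h6 : ‖L τ (0, W, 0)‖ ≤ β * ‖W‖ := by
      refine ((L τ).le_opNorm _).trans ?_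
      gcongr
      · exact hβ τ hτ
      · simp [Prod.norm_def]
    have h7 : ‖Z (τ, p') - Z (τ, p)‖ ≤ ‖W‖ + α * ‖p' - p‖ := by
      have h8 : Z (τ, p') - Z (τ, p) = W + A (τ, p) (p' - p) := by simp [hW]
      rw [h8]
      refine (norm_add_le _ _).trans ?_
      gcongr
      exact (A (τ, p)).le_of_opNorm_le (hα τ hτ) _
    rw [h5]
    refine (norm_add_le _ _).trans ?_
    have h9 := hmv τ hτ
    have h10 : ε * (‖Z (τ, p') - Z (τ, p)‖ + ‖p' - p‖) ≤
        ε * (‖W‖ + α * ‖p' - p‖ + ‖p' - p‖) := by gcongr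
    have h11 : ε * ‖W‖ ≤ 1 * ‖W‖ := by gcongr
    nlinarith

end ParametricSolution

/-! ### Higher derivatives by induction -/

section Regularity

variable {E P : Type*} [NormedAddCommGroup E] [NormedSpace ℝ E]
  [NormedAddCommGroup P] [NormedSpace ℝ P] {Q : Set P} {F : ℝ × E × P → E}

/-- The projection `(τ, (z, A), p) ↦ (τ, z, p)`. -/
noncomputable def forgetVariation (E P : Type*) [NormedAddCommGroup E] [NormedSpace ℝ E]
    [NormedAddCommGroup P] [NormedSpace ℝ P] :
    ℝ × (E × (P →L[ℝ] E)) × P →L[ℝ] ℝ × E × P :=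
  (ContinuousLinearMap.id ℝ ℝ).prodMap
    ((ContinuousLinearMap.fst ℝ E (P →L[ℝ] E)).prodMap (ContinuousLinearMap.id ℝ P))

theorem norm_forgetVariation_le : ‖forgetVariation E P‖ ≤ 1 := by
  refine ContinuousLinearMap.opNorm_le_bound _ zero_le_one fun q => ?_
  simp only [forgetVariation, ContinuousLinearMap.coe_prodMap', Prod.norm_def, one_mul]
  exact max_le_max le_rfl (max_le_max (le_max_left _ _) le_rfl)

theorem preimage_forgetVariation :
    forgetVariation E P ⁻¹' paramDomain E Q = paramDomain (E × (P →L[ℝ] E)) Q := by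
  ext ⟨τ, ⟨z, A⟩, p⟩
  simp [forgetVariation, paramDomain]

theorem contDiff_graphDirection {n : WithTop ℕ∞} :
    ContDiff ℝ n (graphDirection : (P →L[ℝ] E) → P →L[ℝ] ℝ × E × P) := by
  rw [show (graphDirection : (P →L[ℝ] E) → P →L[ℝ] ℝ × E × P) = _ from funext graphDirection_eq]
  exact (contDiff_const.clm_comp contDiff_id).add contDiff_const

theorem contDiff_graphDirection_snd {n : WithTop ℕ∞} :
    ContDiff ℝ n fun q : ℝ × (E × (P →L[ℝ] E)) × P => graphDirection q.2.1.2 :=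
  contDiff_graphDirection.comp
    (contDiff_snd.comp (contDiff_fst.comp contDiff_snd) :
      ContDiff ℝ n fun q : ℝ × (E × (P →L[ℝ] E)) × P => q.2.1.2)

theorem contDiffOn_variationField (hQ : UniqueDiffOn ℝ Q) {k : ℕ}
    (hF : ContDiffOn ℝ (k + 1 : ℕ) F (paramDomain E Q)) :
    ContDiffOn ℝ k (variationField Q F) (paramDomain (E × (P →L[ℝ] E)) Q) := by
  have hm : MapsTo (forgetVariation E P) (paramDomain (E × (P →L[ℝ] E)) Q) (paramDomain E Q) :=
    preimage_forgetVariation.symm.subset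
  have h1 := (hF.of_le (by exact_mod_cast k.le_succ : (k : WithTop ℕ∞) ≤ (k + 1 : ℕ))).comp
    (forgetVariation E P).contDiff.contDiffOn hm
  have h2 := (hF.fderivWithin (m := k) (uniqueDiffOn_paramDomain hQ) (by norm_cast)).comp
    (forgetVariation E P).contDiff.contDiffOn hm
  exact h1.prodMk (h2.clm_comp contDiff_graphDirection_snd.contDiffOn)

theorem norm_iteratedFDerivWithin_comp_forgetVariation_le {G : Type*} [NormedAddCommGroup G]
    [NormedSpace ℝ G] {g : ℝ × E × P → G} (hQ : UniqueDiffOn ℝ Q) {k j : ℕ} (hj : j ≤ k)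
    (hg : ContDiffOn ℝ k g (paramDomain E Q)) {q : ℝ × (E × (P →L[ℝ] E)) × P}
    (hq : q ∈ paramDomain (E × (P →L[ℝ] E)) Q) :
    ‖iteratedFDerivWithin ℝ j (g ∘ forgetVariation E P) (paramDomain (E × (P →L[ℝ] E)) Q) q‖ ≤
      ‖iteratedFDerivWithin ℝ j g (paramDomain E Q) (forgetVariation E P q)‖ := by
  have hq' : forgetVariation E P q ∈ paramDomain E Q := preimage_forgetVariation.symm.subset hq
  rw [← preimage_forgetVariation, (forgetVariation E P).iteratedFDerivWithin_comp_right hg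
    (uniqueDiffOn_paramDomain hQ) (by
      rw [preimage_forgetVariation]; exact uniqueDiffOn_paramDomain hQ) hq' (by exact_mod_cast hj)]
  refine (ContinuousMultilinearMap.norm_compContinuousLinearMap_le _ _).trans ?_
  refine mul_le_of_le_one_right (norm_nonneg _) ?_
  exact Finset.prod_le_one (fun _ _ => norm_nonneg _) fun _ _ => norm_forgetVariation_le

theorem norm_iteratedFDerivWithin_le_of_fderivWithin_eq_const {G H : Type*} [NormedAddCommGroup G]
    [NormedSpace ℝ G] [NormedAddCommGroup H] [NormedSpace ℝ H] {f : G → H} {S : Set G}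
    (hS : UniqueDiffOn ℝ S) {φ : G →L[ℝ] H} (hf : ∀ q ∈ S, fderivWithin ℝ f S q = φ) (j : ℕ)
    {q : G} (hq : q ∈ S) : ‖iteratedFDerivWithin ℝ j f S q‖ ≤ max ‖f q‖ ‖φ‖ := by
  rcases j with _ | j
  · rw [norm_iteratedFDerivWithin_zero]
    exact le_max_left _ _
  · rw [← norm_iteratedFDerivWithin_fderivWithin hS hq, iteratedFDerivWithin_congr hf hq]
    rcases j with _ | j
    · rw [norm_iteratedFDerivWithin_zero]
      exact le_max_right _ _
    · rw [iteratedFDerivWithin_succ_const, Pi.zero_apply, norm_zero]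
      positivity

/-- The map is affine with linear part of norm at most `1`, so one bound covers the value, the first
derivative and the vanishing higher ones. -/
theorem norm_iteratedFDerivWithin_graphDirection_le {S : Set (ℝ × (E × (P →L[ℝ] E)) × P)}
    (hS : UniqueDiffOn ℝ S) (j : ℕ) {q : ℝ × (E × (P →L[ℝ] E)) × P} (hq : q ∈ S) :
    ‖iteratedFDerivWithin ℝ j (fun q : ℝ × (E × (P →L[ℝ] E)) × P => graphDirection q.2.1.2) S q‖ ≤
      ‖q.2.1.2‖ + 1 := by
  set ℓ : ℝ × (E × (P →L[ℝ] E)) × P →L[ℝ] P →L[ℝ] E :=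
    (ContinuousLinearMap.snd ℝ E (P →L[ℝ] E)).comp
      ((ContinuousLinearMap.fst ℝ (E × (P →L[ℝ] E)) P).comp
        (ContinuousLinearMap.snd ℝ ℝ ((E × (P →L[ℝ] E)) × P))) with hℓ
  have hℓ1 : ‖ℓ‖ ≤ 1 := by
    refine ContinuousLinearMap.opNorm_le_bound _ zero_le_one fun q => ?_
    rw [one_mul]
    exact (norm_snd_le q.2.1).trans ((norm_fst_le q.2).trans (norm_snd_le q))
  set J : (P →L[ℝ] E) →L[ℝ] P →L[ℝ] ℝ × E × P :=
    ContinuousLinearMap.compL ℝ P E (ℝ × E × P) ((ContinuousLinearMap.inr ℝ ℝ (E × P)).comp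
      (ContinuousLinearMap.inl ℝ E P)) with hJ
  have hJA : ∀ A, J A = graphDirection A - graphDirection 0 := fun A => by
    rw [graphDirection_eq, graphDirection_eq]; simp [hJ]
  have hJ1 : ‖J‖ ≤ 1 := by
    refine ContinuousLinearMap.opNorm_le_bound _ zero_le_one fun A => ?_
    rw [hJA, one_mul]
    simpa using norm_graphDirection_sub_le A 0
  have hfd : ∀ q ∈ S, fderivWithin ℝ
      (fun q : ℝ × (E × (P →L[ℝ] E)) × P => graphDirection q.2.1.2) S q = J.comp ℓ := by
    intro q hq
    refine HasFDerivWithinAt.fderivWithin (HasFDerivAt.hasFDerivWithinAt ?_) (hS q hq)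
    have := ((J.comp ℓ).hasFDerivAt (x := q)).add_const (graphDirection (0 : P →L[ℝ] E))
    refine this.congr_of_eventuallyEq (Eventually.of_forall fun r => ?_)
    simp [hJA, hℓ]
  refine (norm_iteratedFDerivWithin_le_of_fderivWithin_eq_const hS hfd j hq).trans
    (max_le (norm_graphDirection_le _) ?_)
  have := (ContinuousLinearMap.opNorm_comp_le J ℓ).trans (mul_le_one₀ hJ1 (norm_nonneg _) hℓ1)
  linarith [norm_nonneg q.2.1.2]

/-- The term `M` comes from the component `F`. The other comes from the Leibniz rule for the
composition, with binomial coefficients summing to at most `2 ^ k`. -/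
theorem norm_iteratedFDerivWithin_variationField_le (hQ : UniqueDiffOn ℝ Q) {k j : ℕ} (hj : j ≤ k)
    (hF : ContDiffOn ℝ (k + 1 : ℕ) F (paramDomain E Q)) {q : ℝ × (E × (P →L[ℝ] E)) × P}
    (hq : q ∈ paramDomain (E × (P →L[ℝ] E)) Q) {M α : ℝ}
    (hM : ∀ i ≤ k + 1, ‖iteratedFDerivWithin ℝ i F (paramDomain E Q) (forgetVariation E P q)‖ ≤ M)
    (hα : ‖q.2.1.2‖ ≤ α) :
    ‖iteratedFDerivWithin ℝ j (variationField Q F) (paramDomain (E × (P →L[ℝ] E)) Q) q‖ ≤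
      M + 2 ^ k * M * (α + 1) := by
  have hM0 : 0 ≤ M := (norm_nonneg _).trans (hM 0 (Nat.zero_le _))
  have hα0 : 0 ≤ α := (norm_nonneg _).trans hα
  have hS := uniqueDiffOn_paramDomain (E := E) hQ
  have hS' := uniqueDiffOn_paramDomain (E := E × (P →L[ℝ] E)) hQ
  have hq' : forgetVariation E P q ∈ paramDomain E Q := preimage_forgetVariation.symm.subset hq
  have hm : MapsTo (forgetVariation E P) (paramDomain (E × (P →L[ℝ] E)) Q) (paramDomain E Q) :=
    preimage_forgetVariation.symm.subset
  have hFk : ContDiffOn ℝ k F (paramDomain E Q) :=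
    hF.of_le (by exact_mod_cast k.le_succ)
  have hDF : ContDiffOn ℝ k (fderivWithin ℝ F (paramDomain E Q)) (paramDomain E Q) :=
    hF.fderivWithin hS (by norm_cast)
  have h1 := hFk.comp (forgetVariation E P).contDiff.contDiffOn hm
  have h2 := hDF.comp (forgetVariation E P).contDiff.contDiffOn hm
  have h3 : ContDiffOn ℝ k (fun q : ℝ × (E × (P →L[ℝ] E)) × P => graphDirection q.2.1.2)
      (paramDomain (E × (P →L[ℝ] E)) Q) :=
    contDiff_graphDirection_snd.contDiffOn
  have hjk : (j : WithTop ℕ∞) ≤ k := by exact_mod_cast hj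
  have heq : variationField Q F = fun q => ((F ∘ forgetVariation E P) q,
      ((fderivWithin ℝ F (paramDomain E Q) ∘ forgetVariation E P) q).comp
        (graphDirection q.2.1.2)) := rfl
  rw [heq, iteratedFDerivWithin_prodMk (h1 q hq) ((h2.clm_comp h3) q hq) hS' hq hjk,
    ContinuousMultilinearMap.opNorm_prod]
  refine max_le ?_ ?_
  · have := (norm_iteratedFDerivWithin_comp_forgetVariation_le hQ hj hFk hq).trans
      (hM j (by omega))
    have h4 : 0 ≤ 2 ^ k * M * (α + 1) := by positivity
    linarith
  · refine ((ContinuousLinearMap.compL ℝ P (ℝ × E × P) E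
      ).norm_iteratedFDerivWithin_le_of_bilinear_of_le_one h2 h3 hS' hq hjk
      (ContinuousLinearMap.norm_compL_le ℝ P (ℝ × E × P) E)).trans ?_
    have h4 : ∀ i ∈ Finset.range (j + 1), (j.choose i : ℝ) *
        ‖iteratedFDerivWithin ℝ i (fderivWithin ℝ F (paramDomain E Q) ∘ forgetVariation E P)
          (paramDomain (E × (P →L[ℝ] E)) Q) q‖ *
        ‖iteratedFDerivWithin ℝ (j - i)
          (fun q : ℝ × (E × (P →L[ℝ] E)) × P => graphDirection q.2.1.2)
          (paramDomain (E × (P →L[ℝ] E)) Q) q‖ ≤ (j.choose i : ℝ) * M * (α + 1) := by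
      intro i hi
      have hi' : i ≤ k := (Finset.mem_range_succ_iff.1 hi).trans hj
      gcongr
      · refine (norm_iteratedFDerivWithin_comp_forgetVariation_le hQ hi' hDF hq).trans ?_
        rw [norm_iteratedFDerivWithin_fderivWithin hS hq']
        exact hM _ (by omega)
      · exact (norm_iteratedFDerivWithin_graphDirection_le hS' _ hq).trans (by linarith)
    refine (Finset.sum_le_sum h4).trans ?_
    rw [← Finset.sum_mul, ← Finset.sum_mul, ← Nat.cast_sum, Nat.sum_range_choose, Nat.cast_pow,
      Nat.cast_ofNat]
    have h5 : (2 : ℝ) ^ j ≤ 2 ^ k := pow_le_pow_right₀ one_le_two hj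
    have h6 : (2 : ℝ) ^ j * M * (α + 1) ≤ 2 ^ k * M * (α + 1) := by gcongr
    linarith

/-- A bound for the derivatives of order at most `k` of a parametric solution, in terms of a bound
for the derivatives of the field along the trajectory. -/
noncomputable def solutionBound : ℕ → ℝ → ℝ
  | 0, M => M
  | k + 1, M => solutionBound k (M + 2 ^ k * M * (M * Real.exp M + 1))

/-- The induction keeps `P` and `Q` but replaces `E` by `E × (P →L[ℝ] E)`. Hence `E` is quantified
after `k` and shares the universe of `P`. -/
theorem parametricSolution_regularity {P : Type u} [NormedAddCommGroup P] [NormedSpace ℝ P]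
    {Q : Set P} (k : ℕ) : ∀ {E : Type u} [NormedAddCommGroup E]
    [NormedSpace ℝ E] [CompleteSpace E] {F : ℝ × E × P → E} {Z : ℝ × P → E}, Convex ℝ Q →
    UniqueDiffOn ℝ Q → ContDiffOn ℝ k F (paramDomain E Q) → ContinuousOn Z (Icc 0 1 ×ˢ Q) →
    IsParametricSolution Q F Z → ∀ τ ∈ Icc (0 : ℝ) 1,
      ContDiffOn ℝ k (fun p => Z (τ, p)) Q ∧ ∀ p ∈ Q, ∀ M : ℝ,
        (∀ σ ∈ Icc (0 : ℝ) 1, ∀ j ≤ k,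
          ‖iteratedFDerivWithin ℝ j F (paramDomain E Q) (σ, Z (σ, p), p)‖ ≤ M) →
        ∀ j ≤ k, ‖iteratedFDerivWithin ℝ j (fun p => Z (τ, p)) Q p‖ ≤ solutionBound k M := by
  induction k with
  | zero =>
    intro E _ _ _ F Z hQc hQ hF hZ hsol τ hτ
    refine ⟨contDiffOn_zero.2 (hZ.comp (by fun_prop) fun p hp => ⟨hτ, hp⟩),
      fun p hp M hM j hj => ?_⟩
    obtain rfl := Nat.le_zero.1 hj
    rw [norm_iteratedFDerivWithin_zero, solutionBound]
    have hM' : ∀ σ ∈ Icc (0 : ℝ) 1, ‖F (σ, Z (σ, p), p)‖ ≤ M := fun σ hσ => by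
      simpa using hM σ hσ 0 le_rfl
    have := norm_le_of_norm_deriv_le_mul_add le_rfl ((norm_nonneg _).trans (hM' 0 (by simp)))
      (hsol p hp).2 (fun σ hσ => (hM' σ hσ).trans (by simp)) τ hτ
    simpa [(hsol p hp).1] using this
  | succ k ih =>
    intro E _ _ _ F Z hQc hQ hF hZ hsol τ hτ
    have hF1 : ContDiffOn ℝ 1 F (paramDomain E Q) :=
      hF.of_le (by exact_mod_cast Nat.succ_le_succ k.zero_le)
    obtain ⟨A, hA, hsolA⟩ := exists_variation hQ hF1 hZ hsol
    have hd : ∀ p ∈ Q, HasFDerivWithinAt (fun p => Z (τ, p)) (A (τ, p)) Q p := fun p hp =>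
      hasFDerivWithinAt_of_variation hQc hQ hF1 hZ hsolA hτ hp
    have hfd : ∀ p ∈ Q, fderivWithin ℝ (fun p => Z (τ, p)) Q p = A (τ, p) := fun p hp =>
      (hd p hp).fderivWithin (hQ p hp)
    obtain ⟨hreg, hbd⟩ := ih hQc hQ (contDiffOn_variationField hQ hF) (hZ.prodMk hA) hsolA τ hτ
    refine ⟨?_, fun p hp M hM j hj => ?_⟩
    · push_cast
      rw [contDiffOn_succ_iff_fderivWithin hQ]
      exact ⟨fun p hp => (hd p hp).differentiableWithinAt, by simp, hreg.snd.congr hfd⟩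
    -- Grönwall for `‖A'‖ ≤ M (‖A‖ + 1)`, `A(0) = 0`; this bound feeds the recursion in
    -- `solutionBound`.
    · have hA1 : ∀ σ ∈ Icc (0 : ℝ) 1, ‖A (σ, p)‖ ≤ M * Real.exp M := by
        have hM0 : 0 ≤ M := (norm_nonneg _).trans (hM 0 (by simp) 0 (Nat.zero_le _))
        have h0 : A (0, p) = 0 := congrArg Prod.snd (hsolA p hp).1
        intro σ hσ
        have := norm_le_of_norm_deriv_le_mul_add hM0 hM0 (fun σ hσ => ((hsolA p hp).2 σ hσ).snd)
          (fun σ hσ => ?_) σ hσ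
        · simpa [h0] using this
        · refine (ContinuousLinearMap.opNorm_comp_le _ _).trans ?_
          have h1 : ‖fderivWithin ℝ F (paramDomain E Q) (σ, Z (σ, p), p)‖ ≤ M := by
            have h2 := hM σ hσ 1 (by omega)
            have hm : (σ, Z (σ, p), p) ∈ paramDomain E Q := ⟨hσ, mem_univ _, hp⟩
            rwa [← zero_add 1, ← norm_iteratedFDerivWithin_fderivWithin
              (uniqueDiffOn_paramDomain hQ) hm, norm_iteratedFDerivWithin_zero] at h2
          calc _ ≤ M * (‖A (σ, p)‖ + 1) := by
                gcongr
                exact norm_graphDirection_le _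
            _ = _ := by ring
      have hbd' := hbd p hp (M + 2 ^ k * M * (M * Real.exp M + 1)) fun σ hσ i hi =>
        norm_iteratedFDerivWithin_variationField_le hQ hi hF ⟨hσ, mem_univ _, hp⟩
          (fun i hi => hM σ hσ i hi) (hA1 σ hσ)
      rcases j with _ | j
      · have := hbd' 0 (Nat.zero_le _)
        rw [norm_iteratedFDerivWithin_zero] at this ⊢
        exact (norm_fst_le (Z (τ, p), A (τ, p))).trans this
      · have hjk : (j : WithTop ℕ∞) ≤ k := by exact_mod_cast Nat.le_of_succ_le_succ hj
        rw [← norm_iteratedFDerivWithin_fderivWithin hQ hp, iteratedFDerivWithin_congr hfd hp]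
        have h1 := (ContinuousLinearMap.snd ℝ E (P →L[ℝ] E)).norm_iteratedFDerivWithin_comp_left
          (hreg p hp) hQ hp hjk
        refine h1.trans ((mul_le_of_le_one_left (norm_nonneg _)
          (ContinuousLinearMap.norm_snd_le ℝ E (P →L[ℝ] E))).trans
            (hbd' j (Nat.le_of_succ_le_succ hj)))

end Regularity

/-! ### Bounds on compact sets and continuity of solutions -/

section LocalBounds

variable {E P G : Type*} [NormedAddCommGroup E] [NormedSpace ℝ E]
  [NormedAddCommGroup P] [NormedSpace ℝ P] [NormedAddCommGroup G] [NormedSpace ℝ G]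

theorem exists_bound_iteratedFDerivWithin {f : E → G} {S K : Set E} {k : ℕ}
    (hS : UniqueDiffOn ℝ S) (hf : ContDiffOn ℝ k f S) (hK : IsCompact K) (hKS : K ⊆ S) :
    ∃ c : ℝ, 1 ≤ c ∧ ∀ j ≤ k, ∀ q ∈ K, ‖iteratedFDerivWithin ℝ j f S q‖ ≤ c := by
  have h : ∀ j : ℕ, ∃ c : ℝ, j ≤ k → ∀ q ∈ K, ‖iteratedFDerivWithin ℝ j f S q‖ ≤ c := by
    intro j
    by_cases hj : j ≤ k
    · obtain ⟨c, hc⟩ := hK.exists_bound_of_continuousOn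
        ((hf.continuousOn_iteratedFDerivWithin (m := j) (by exact_mod_cast hj) hS).mono hKS)
      exact ⟨c, fun _ => hc⟩
    · exact ⟨0, fun h => absurd h hj⟩
  choose c hc using h
  refine ⟨1 + ∑ j ∈ Finset.range (k + 1), |c j|,
    le_add_of_nonneg_right (Finset.sum_nonneg fun _ _ => abs_nonneg _), fun j hj q hq => ?_⟩
  have h1 : |c j| ≤ ∑ j ∈ Finset.range (k + 1), |c j| :=
    Finset.single_le_sum (f := fun j => |c j|) (fun _ _ => abs_nonneg _)
      (Finset.mem_range_succ_iff.2 hj)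
  linarith [hc j hj q hq, le_abs_self (c j)]

theorem exists_lipschitzOnWith_slice [ProperSpace E] {f : ℝ × E × P → G} {a b : ℝ} {Q : Set P}
    (hu : UniqueDiffOn ℝ (Icc a b ×ˢ (univ : Set E) ×ˢ Q))
    (hf : ContDiffOn ℝ 1 f (Icc a b ×ˢ (univ : Set E) ×ˢ Q)) {p : P} (hp : p ∈ Q) (R : ℝ) :
    ∃ K : ℝ≥0, ∀ σ ∈ Icc a b, LipschitzOnWith K (fun z => f (σ, z, p)) (closedBall 0 R) := by
  have hDf := hf.continuousOn_fderivWithin hu le_rfl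
  obtain ⟨c, hc⟩ := ((isCompact_Icc (a := a) (b := b)).prod ((isCompact_closedBall (0 : E) R).prod
    (isCompact_singleton (x := p)))).exists_bound_of_continuousOn
    (hDf.mono (prod_mono le_rfl (prod_mono (subset_univ _) (singleton_subset_iff.2 hp))))
  refine ⟨c.toNNReal, fun σ hσ => LipschitzOnWith.of_dist_le_mul fun z hz w hw => ?_⟩
  have hsub : ({σ} ×ˢ closedBall (0 : E) R ×ˢ {p} : Set (ℝ × E × P)) ⊆
      Icc a b ×ˢ (univ : Set E) ×ˢ Q :=
    prod_mono (singleton_subset_iff.2 hσ) (prod_mono (subset_univ _) (singleton_subset_iff.2 hp))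
  have hconv : Convex ℝ ({σ} ×ˢ closedBall (0 : E) R ×ˢ {p} : Set (ℝ × E × P)) :=
    (convex_singleton σ).prod ((convex_closedBall _ _).prod (convex_singleton p))
  have key := hconv.norm_image_sub_le_of_norm_hasFDerivWithin_le (f := f) (C := c)
    (fun x hx => ((hf.differentiableOn one_ne_zero x (hsub hx)).hasFDerivWithinAt).mono hsub)
    (fun x hx => hc x ⟨(mem_singleton_iff.1 hx.1) ▸ hσ, hx.2⟩)
    (x := (σ, w, p)) (y := (σ, z, p)) ⟨rfl, hw, rfl⟩ ⟨rfl, hz, rfl⟩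
  rw [dist_eq_norm, dist_eq_norm]
  refine key.trans ?_
  rw [Prod.mk_sub_mk, Prod.mk_sub_mk, sub_self, sub_self, Prod.norm_mk, Prod.norm_mk, norm_zero,
    norm_zero, max_eq_left (norm_nonneg _), max_eq_right (norm_nonneg _)]
  gcongr
  exact Real.le_coe_toNNReal c

/-- Local boundedness keeps nearby curves in a compact ball, where `F` is Lipschitz in `z` and
uniformly close to its value at `p`. -/
theorem continuousOn_parametricSolution [ProperSpace E] {F : ℝ × E × P → E} {Z : ℝ × P → E}
    {Q : Set P} (hQ : UniqueDiffOn ℝ Q) (hF : ContDiffOn ℝ 1 F (paramDomain E Q))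
    (hZ : IsParametricSolution Q F Z)
    (hb : ∀ p ∈ Q, ∃ R : ℝ, ∀ᶠ p' in 𝓝[Q] p, ∀ τ ∈ Icc (0 : ℝ) 1, ‖Z (τ, p')‖ ≤ R) :
    ContinuousOn Z (Icc 0 1 ×ˢ Q) := by
  refine continuousOn_of_norm_deriv_sub_le (v := fun y => F (y.1, Z y, y.2))
    (fun p hp => (hZ p hp).1) (fun p hp => (hZ p hp).2) fun p hp => ?_
  obtain ⟨R, hR⟩ := hb p hp
  obtain ⟨K, hK⟩ := exists_lipschitzOnWith_slice (uniqueDiffOn_paramDomain hQ) hF hp R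
  refine ⟨K, K.2, fun ε hε => ?_⟩
  have hcont : ContinuousOn (fun y : (ℝ × E) × P => F (y.1.1, y.1.2, y.2))
      ((Icc 0 1 ×ˢ closedBall 0 R) ×ˢ Q) :=
    hF.continuousOn.comp (by fun_prop) fun y hy => ⟨hy.1.1, mem_univ _, hy.2⟩
  filter_upwards [hR, eventually_dist_lt_of_continuousOn
    (isCompact_Icc.prod (isCompact_closedBall (0 : E) R)) hcont hp hε] with p' h1 h2 τ hτ
  have hm' : Z (τ, p') ∈ closedBall (0 : E) R := by simpa using h1 τ hτ
  have hm : Z (τ, p) ∈ closedBall (0 : E) R := by simpa using hR.self_of_nhdsWithin hp τ hτ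
  have h3 := (h2 (τ, Z (τ, p')) ⟨hτ, hm'⟩).le
  have h4 := (hK τ hτ).dist_le_mul _ hm' _ hm
  simp only [← dist_eq_norm] at h3 h4 ⊢
  linarith [dist_triangle (F (τ, Z (τ, p'), p')) (F (τ, Z (τ, p'), p)) (F (τ, Z (τ, p), p))]

end LocalBounds

/-! ### Partial derivatives versus operator norms -/

section Basis

variable {ι E F : Type*} [Fintype ι] [NormedAddCommGroup E] [NormedSpace ℝ E]
  [NormedAddCommGroup F] [NormedSpace ℝ F]

theorem exists_norm_le_mul_of_basis (b : Module.Basis ι ℝ E) (j : ℕ) :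
    ∃ c : ℝ, 0 ≤ c ∧ ∀ (f : ContinuousMultilinearMap ℝ (fun _ : Fin j => E) F) (M : ℝ),
      (∀ l : Fin j → ι, ‖f fun i => b (l i)‖ ≤ M) → ‖f‖ ≤ c * M := by
  classical
  have : FiniteDimensional ℝ E := b.finiteDimensional_of_finite
  set κ : ℝ := ‖(b.equivFunL : E →L[ℝ] ι → ℝ)‖
  have hκ : ∀ v i, ‖b.repr v i‖ ≤ κ * ‖v‖ := fun v i =>
    (norm_le_pi_norm (b.equivFunL v) i).trans ((b.equivFunL : E →L[ℝ] ι → ℝ).le_opNorm v)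
  refine ⟨Fintype.card (Fin j → ι) * κ ^ j, by positivity, fun f M hf => ?_⟩
  -- `M` may be negative only when there are no multi-indices, and then the cardinality is `0`.
  have hM : 0 ≤ Fintype.card (Fin j → ι) * M := by
    rcases isEmpty_or_nonempty (Fin j → ι) with h | ⟨⟨l⟩⟩
    · simp
    · have := (norm_nonneg _).trans (hf l)
      positivity
  refine f.opNorm_le_bound (by rw [mul_right_comm]; positivity) fun v => ?_
  have h1 : f v = ∑ l : Fin j → ι, (∏ i, b.repr (v i) (l i)) • f fun i => b (l i) := by
    conv_lhs => rw [show v = fun i => ∑ m, b.repr (v i) m • b m from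
      funext fun i => (b.sum_repr (v i)).symm]
    rw [f.map_sum]
    exact Finset.sum_congr rfl fun l _ => f.map_smul_univ _ _
  rw [h1]
  refine (norm_sum_le _ _).trans ?_
  calc ∑ l : Fin j → ι, ‖(∏ i, b.repr (v i) (l i)) • f fun i => b (l i)‖
      ≤ ∑ _l : Fin j → ι, (∏ i, κ * ‖v i‖) * M := by
        refine Finset.sum_le_sum fun l _ => ?_
        rw [norm_smul, norm_prod]
        gcongr with i
        · exact hκ _ _
        · exact hf l
    _ = Fintype.card (Fin j → ι) * κ ^ j * M * ∏ i, ‖v i‖ := by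
        rw [Finset.sum_const, Finset.prod_mul_distrib, Finset.prod_const, Finset.card_univ,
          Finset.card_univ, Fintype.card_fin, nsmul_eq_mul]
        ring

theorem exists_norm_iteratedFDerivWithin_le_of_ckNorm_le (b : Module.Basis ι ℝ E) (k : ℕ) :
    ∃ c : ℝ, 0 ≤ c ∧ ∀ (f : E → F) (S Ω : Set E) (M : ℝ), 0 ≤ M →
      ckNorm b k S Ω f ≤ ENNReal.ofReal M →
      ∀ j ≤ k, ∀ p ∈ Ω, ‖iteratedFDerivWithin ℝ j f S p‖ ≤ c * M := by
  choose c hc0 hc using exists_norm_le_mul_of_basis (F := F) b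
  refine ⟨∑ j ∈ Finset.range (k + 1), c j, Finset.sum_nonneg fun j _ => hc0 j,
    fun f S Ω M hM hf j hj p hp => ?_⟩
  refine (hc j _ M fun l => ?_).trans (mul_le_mul_of_nonneg_right
    (Finset.single_le_sum (fun j _ => hc0 j) (Finset.mem_range_succ_iff.2 hj)) hM)
  have h1 : ‖iteratedFDerivWithin ℝ j f S p fun i => b (l i)‖ₑ ≤ ckNorm b k S Ω f :=
    le_iSup₂_of_le j hj (le_iSup_of_le l (le_iSup₂_of_le p hp le_rfl))
  have h2 := h1.trans hf
  rwa [← ofReal_norm, ENNReal.ofReal_le_ofReal_iff hM] at h2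

omit [Fintype ι] in
theorem ckNorm_le_ofReal (b : Module.Basis ι ℝ E) (hb : ∀ i, ‖b i‖ ≤ 1) {k : ℕ} {f : E → F}
    {S Ω : Set E} {M : ℝ} (hf : ∀ j ≤ k, ∀ p ∈ Ω, ‖iteratedFDerivWithin ℝ j f S p‖ ≤ M) :
    ckNorm b k S Ω f ≤ ENNReal.ofReal M := by
  refine iSup₂_le fun j hj => iSup_le fun l => iSup₂_le fun p hp => ?_
  rw [← ofReal_norm]
  refine ENNReal.ofReal_le_ofReal (((iteratedFDerivWithin ℝ j f S p).le_opNorm _).trans ?_)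
  exact (mul_le_of_le_one_right (norm_nonneg _)
    (Finset.prod_le_one (fun _ _ => norm_nonneg _) fun i _ => hb (l i))).trans (hf j hj p hp)

theorem norm_fieldBasis_le (n D : ℕ) (i : Unit ⊕ (Fin n ⊕ Fin D)) : ‖fieldBasis n D i‖ ≤ 1 := by
  rcases i with i | i | i
  · simp [fieldBasis, Prod.norm_def]
  · simp [fieldBasis, Prod.norm_def]
  · simpa [fieldBasis, Prod.norm_def] using (Pi.norm_single (G := fun _ : Fin D => ℝ) (i := i) (1 : ℝ)).le

theorem norm_flowBasis_le (n D : ℕ) (i : Unit ⊕ (Unit ⊕ (Fin n ⊕ Fin D))) :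
    ‖flowBasis n D i‖ ≤ 1 := by
  rcases i with i | i
  · simp [flowBasis, Prod.norm_def]
  · simpa [flowBasis, Prod.norm_def] using norm_fieldBasis_le n D i

end Basis

/-! ### The domains -/

section Domains

variable {n D : ℕ} {T : ℝ}

theorem isCompact_fieldDomain {A : Set (EuclideanSpace ℝ (Fin n))} (hA : IsCompact A) :
    IsCompact (fieldDomain D T A) :=
  isCompact_Icc.prod (hA.prod isCompact_Icc)

theorem isCompact_flowDomain {A : Set (EuclideanSpace ℝ (Fin n))} (hA : IsCompact A) :
    IsCompact (flowDomain D T A) :=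
  isCompact_Icc.prod (isCompact_fieldDomain hA)

theorem fieldDomain_mono {A B : Set (EuclideanSpace ℝ (Fin n))} (h : A ⊆ B) :
    fieldDomain D T A ⊆ fieldDomain D T B :=
  prod_mono le_rfl (prod_mono h le_rfl)

theorem flowDomain_mono {A B : Set (EuclideanSpace ℝ (Fin n))} (h : A ⊆ B) :
    flowDomain D T A ⊆ flowDomain D T B :=
  prod_mono le_rfl (fieldDomain_mono h)

theorem uniqueDiffOn_fieldDomain (hT : 0 < T) :
    UniqueDiffOn ℝ (fieldDomain D T (univ : Set (EuclideanSpace ℝ (Fin n)))) := by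
  refine (uniqueDiffOn_Icc hT).prod (uniqueDiffOn_univ.prod ?_)
  rw [← pi_univ_Icc]
  exact UniqueDiffOn.univ_pi fun i => uniqueDiffOn_Icc zero_lt_one

theorem uniqueDiffOn_flowDomain (hT : 0 < T) :
    UniqueDiffOn ℝ (flowDomain D T (univ : Set (EuclideanSpace ℝ (Fin n)))) :=
  (uniqueDiffOn_Icc hT).prod (uniqueDiffOn_fieldDomain hT)

theorem convex_flowDomain :
    Convex ℝ (flowDomain D T (univ : Set (EuclideanSpace ℝ (Fin n)))) :=
  (convex_Icc _ _).prod ((convex_Icc _ _).prod (convex_univ.prod (convex_Icc _ _)))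

end Domains

/-! ### The characteristic flow as a parametric solution -/

section Flow

variable {n D : ℕ} {T C : ℝ} {V : FieldVar n D → EuclideanSpace ℝ (Fin n)}
  {X : FlowVar n D → EuclideanSpace ℝ (Fin n)}

theorem exists_isCharacteristicFlow (hT : 0 < T) (hC : 0 < C)
    (hV : ContDiffOn ℝ 1 V (fieldDomain D T univ)) (hgrowth : LinearGrowth T C V) :
    ∃ X : FlowVar n D → EuclideanSpace ℝ (Fin n), IsCharacteristicFlow T V X := by
  have hex : ∀ p : FieldVar n D, ∃ u : ℝ → EuclideanSpace ℝ (Fin n),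
      p.1 ∈ Icc 0 T → p.2.2 ∈ Icc (0 : Fin D → ℝ) 1 → u p.1 = p.2.1 ∧
        ∀ s ∈ Icc 0 T, HasDerivWithinAt u (V (s, u s, p.2.2)) (Icc 0 T) s := by
    rintro ⟨t, x, η⟩
    by_cases h : t ∈ Icc 0 T ∧ η ∈ Icc (0 : Fin D → ℝ) 1
    · obtain ⟨u, hu⟩ := exists_solution_of_linear_growth (f := fun σ y => V (σ, y, η)) h.1 hC.le
        (fun R => exists_lipschitzOnWith_slice (uniqueDiffOn_fieldDomain hT) hV h.2 R)
        (fun y => hV.continuousOn.comp (by fun_prop) fun σ hσ => ⟨hσ, mem_univ _, h.2⟩)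
        (fun σ hσ y => hgrowth σ hσ y η h.2) x
      exact ⟨u, fun _ _ => hu⟩
    · exact ⟨0, fun h1 h2 => absurd ⟨h1, h2⟩ h⟩
  choose u hu using hex
  exact ⟨fun q => u q.2 q.1, fun t ht x η hη => hu (t, x, η) ht hη⟩

theorem IsCharacteristicFlow.norm_le (hX : IsCharacteristicFlow T V X) (hC : 0 < C)
    (hgrowth : LinearGrowth T C V) {s t : ℝ} (hs : s ∈ Icc 0 T) (ht : t ∈ Icc 0 T)
    (x : EuclideanSpace ℝ (Fin n)) {η : Fin D → ℝ} (hη : η ∈ Icc (0 : Fin D → ℝ) 1) :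
    ‖X (s, t, x, η)‖ ≤ confiningRadius T C ‖x‖ := by
  have := norm_le_of_norm_deriv_le_growth (u := fun σ => X (σ, t, x, η)) hC.le ht hs
    (hX t ht x η hη).2 (fun σ hσ => hgrowth σ hσ _ η hη)
  simpa [(hX t ht x η hη).1, confiningRadius] using this

theorem confiningRadius_mono (_ : 0 < T) (_ : 0 < C) : Monotone (confiningRadius T C) := by
  intro R R' h
  unfold confiningRadius
  gcongr

/-- The point `(t + τ (s - t), x + z, η)`, as a function of `(τ, z, (s, t, x, η))`. -/
noncomputable def segmentPoint (q : ℝ × EuclideanSpace ℝ (Fin n) × FlowVar n D) : FieldVar n D :=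
  (q.2.2.2.1 + q.1 * (q.2.2.1 - q.2.2.2.1), q.2.2.2.2.1 + q.2.1, q.2.2.2.2.2)

/-- The field on `[0,1]` solved by the displacements from `x` of the characteristic curves,
reparametrised so that they run from time `t` to time `s`. -/
noncomputable def segmentField (V : FieldVar n D → EuclideanSpace ℝ (Fin n))
    (q : ℝ × EuclideanSpace ℝ (Fin n) × FlowVar n D) : EuclideanSpace ℝ (Fin n) :=
  (q.2.2.1 - q.2.2.2.1) • V (segmentPoint q)

/-- The displacement from `x` of the characteristic curve through `(t, x, η)`, reparametrised so
that it runs from time `t` to time `s`. -/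
noncomputable def segmentCurve (X : FlowVar n D → EuclideanSpace ℝ (Fin n))
    (y : ℝ × FlowVar n D) : EuclideanSpace ℝ (Fin n) :=
  X (y.2.2.1 + y.1 * (y.2.1 - y.2.2.1), y.2.2) - y.2.2.2.1

theorem segment_mem_Icc {s t τ : ℝ} (hs : s ∈ Icc 0 T) (ht : t ∈ Icc 0 T)
    (hτ : τ ∈ Icc (0 : ℝ) 1) : t + τ * (s - t) ∈ Icc 0 T := by
  simpa using (convex_Icc 0 T).add_smul_sub_mem ht hs hτ

theorem contDiff_segmentPoint {m : WithTop ℕ∞} :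
    ContDiff ℝ m (segmentPoint (n := n) (D := D)) := by
  unfold segmentPoint
  fun_prop

theorem contDiff_segmentDuration {m : WithTop ℕ∞} : ContDiff ℝ m
    fun q : ℝ × EuclideanSpace ℝ (Fin n) × FlowVar n D => q.2.2.1 - q.2.2.2.1 := by
  fun_prop

theorem mapsTo_segmentPoint : MapsTo (segmentPoint (n := n) (D := D))
    (paramDomain (EuclideanSpace ℝ (Fin n)) (flowDomain D T univ)) (fieldDomain D T univ) :=
  fun _ hq => ⟨segment_mem_Icc hq.2.2.1 hq.2.2.2.1 hq.1, mem_univ _, hq.2.2.2.2.2⟩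

theorem contDiffOn_segmentField {m : WithTop ℕ∞} (hV : ContDiffOn ℝ m V (fieldDomain D T univ)) :
    ContDiffOn ℝ m (segmentField V)
      (paramDomain (EuclideanSpace ℝ (Fin n)) (flowDomain D T univ)) :=
  contDiff_segmentDuration.contDiffOn.smul
    (hV.comp contDiff_segmentPoint.contDiffOn mapsTo_segmentPoint)

theorem IsCharacteristicFlow.isParametricSolution (hX : IsCharacteristicFlow T V X) :
    IsParametricSolution (flowDomain D T univ) (segmentField V) (segmentCurve X) := by
  rintro ⟨s, t, x, η⟩ ⟨hs, ht, -, hη⟩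
  refine ⟨by simp [segmentCurve, (hX t ht x η hη).1], fun τ hτ => ?_⟩
  have := (hasDerivWithinAt_segment (u := fun σ => X (σ, t, x, η)) ht hs (hX t ht x η hη).2
    hτ).sub_const x
  simpa [segmentField, segmentPoint, segmentCurve] using this

/-- The definition of a flow requires no continuity in `(t,x,η)`; confinement supplies the local
bound from which it follows. -/
theorem IsCharacteristicFlow.continuousOn_segmentCurve (hX : IsCharacteristicFlow T V X)
    (hT : 0 < T) (hC : 0 < C) (hV : ContDiffOn ℝ 1 V (fieldDomain D T univ))
    (hgrowth : LinearGrowth T C V) :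
    ContinuousOn (segmentCurve X) (Icc 0 1 ×ˢ flowDomain D T univ) := by
  refine continuousOn_parametricSolution (uniqueDiffOn_flowDomain hT) (contDiffOn_segmentField hV)
    hX.isParametricSolution fun p _ =>
      ⟨confiningRadius T C (‖p.2.2.1‖ + 1) + (‖p.2.2.1‖ + 1), ?_⟩
  have h1 : ∀ᶠ p' in 𝓝[flowDomain D T univ] p, ‖p'.2.2.1‖ < ‖p.2.2.1‖ + 1 := by
    have h2 : ContinuousAt (fun p' : FlowVar n D => ‖p'.2.2.1‖) p := by fun_prop
    exact (h2.eventually_lt continuousAt_const (lt_add_one _)).filter_mono nhdsWithin_le_nhds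
  filter_upwards [h1, self_mem_nhdsWithin] with p' h2 h3 τ hτ
  refine (norm_sub_le _ _).trans (add_le_add ?_ h2.le)
  exact (hX.norm_le hC hgrowth (segment_mem_Icc h3.1 h3.2.1 hτ) h3.2.1 _ h3.2.2.2).trans
    (confiningRadius_mono hT hC h2.le)

theorem eq_add_segmentCurve (p : FlowVar n D) :
    X p = p.2.2.1 + segmentCurve X (1, p) := by
  simp [segmentCurve]

theorem IsCharacteristicFlow.contDiffOn (hX : IsCharacteristicFlow T V X) (hT : 0 < T)
    (hC : 0 < C) {k : ℕ} (hk : 1 ≤ k) (hV : ContDiffOn ℝ k V (fieldDomain D T univ))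
    (hgrowth : LinearGrowth T C V) : ContDiffOn ℝ k X (flowDomain D T univ) := by
  have hV1 : ContDiffOn ℝ 1 V (fieldDomain D T univ) := hV.of_le (by exact_mod_cast hk)
  have h := (parametricSolution_regularity k convex_flowDomain (uniqueDiffOn_flowDomain hT)
    (contDiffOn_segmentField hV) (hX.continuousOn_segmentCurve hT hC hV1 hgrowth)
    hX.isParametricSolution 1 (by simp)).1
  refine ContDiffOn.congr (f := fun p => p.2.2.1 + segmentCurve X (1, p)) ?_
    fun p _ => eq_add_segmentCurve p
  exact ContDiffOn.add (by fun_prop) h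

/-- `V` enters only through its derivatives at `segmentPoint q`; the remaining factors are fixed
smooth maps, bounded on a compact set. Hence `c` is uniform in `V`. -/
theorem exists_bound_iteratedFDerivWithin_segmentField (n D k : ℕ) (hT : 0 < T) (R ρ M : ℝ) :
    ∃ c : ℝ, ∀ V : FieldVar n D → EuclideanSpace ℝ (Fin n),
      ContDiffOn ℝ k V (fieldDomain D T univ) →
      ∀ q ∈ Icc (0 : ℝ) 1 ×ˢ closedBall (0 : EuclideanSpace ℝ (Fin n)) ρ ×ˢ
        flowDomain D T (closedBall (0 : EuclideanSpace ℝ (Fin n)) R),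
      (∀ j ≤ k, ‖iteratedFDerivWithin ℝ j V (fieldDomain D T univ) (segmentPoint q)‖ ≤ M) →
      ∀ j ≤ k, ‖iteratedFDerivWithin ℝ j (segmentField V)
        (paramDomain (EuclideanSpace ℝ (Fin n)) (flowDomain D T univ)) q‖ ≤ c := by
  set B := Icc (0 : ℝ) 1 ×ˢ closedBall (0 : EuclideanSpace ℝ (Fin n)) ρ ×ˢ
    flowDomain D T (closedBall (0 : EuclideanSpace ℝ (Fin n)) R) with hBdef
  set S := paramDomain (EuclideanSpace ℝ (Fin n)) (flowDomain (n := n) D T univ) with hSdef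
  have hS : UniqueDiffOn ℝ S := uniqueDiffOn_paramDomain (uniqueDiffOn_flowDomain hT)
  have hBS : B ⊆ S :=
    prod_mono le_rfl (prod_mono (subset_univ _) (flowDomain_mono (subset_univ _)))
  have hB : IsCompact B := isCompact_Icc.prod
    ((isCompact_closedBall _ _).prod (isCompact_flowDomain (isCompact_closedBall _ _)))
  -- The chain rule estimate wants the `l`-th derivative bounded by `a ^ l`, which `a ≥ 1` ensures
  -- for `l ≥ 1`.
  obtain ⟨a, ha1, ha⟩ := exists_bound_iteratedFDerivWithin (k := k) hS
    (contDiff_segmentPoint (n := n) (D := D)).contDiffOn hB hBS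
  obtain ⟨c, hc1, hc⟩ := exists_bound_iteratedFDerivWithin (k := k) hS
    (contDiff_segmentDuration (n := n) (D := D)).contDiffOn hB hBS
  refine ⟨2 ^ k * c * (k.factorial * M * a ^ k), fun V hV q hq hM j hj => ?_⟩
  have hM0 : 0 ≤ M := (norm_nonneg _).trans (hM 0 (Nat.zero_le _))
  have hcomp : ∀ i ≤ k, ‖iteratedFDerivWithin ℝ i (V ∘ segmentPoint) S q‖ ≤
      k.factorial * M * a ^ k := fun i hi => by
    refine (norm_iteratedFDerivWithin_comp_le hV contDiff_segmentPoint.contDiffOn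
      (by exact_mod_cast hi) (uniqueDiffOn_fieldDomain hT) hS mapsTo_segmentPoint (hBS hq)
      (fun l hl => hM l (hl.trans hi)) (D := a)
      (fun l hl1 hl => (ha l (hl.trans hi) q hq).trans (le_self_pow₀ ha1 (by omega)))).trans ?_
    gcongr
  refine (norm_iteratedFDerivWithin_smul_le (N := k) contDiff_segmentDuration.contDiffOn
    (hV.comp contDiff_segmentPoint.contDiffOn mapsTo_segmentPoint) hS (hBS hq)
    (by exact_mod_cast hj)).trans ?_
  have h : ∀ i ∈ Finset.range (j + 1), (j.choose i : ℝ) *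
      ‖iteratedFDerivWithin ℝ i (fun q : ℝ × EuclideanSpace ℝ (Fin n) × FlowVar n D =>
        q.2.2.1 - q.2.2.2.1) S q‖ *
      ‖iteratedFDerivWithin ℝ (j - i) (V ∘ segmentPoint) S q‖ ≤
      (j.choose i : ℝ) * c * (k.factorial * M * a ^ k) := by
    intro i hi
    have hij := Finset.mem_range_succ_iff.1 hi
    gcongr
    · exact hc i (hij.trans hj) q hq
    · exact hcomp _ (by omega)
  refine (Finset.sum_le_sum h).trans ?_
  rw [← Finset.sum_mul, ← Finset.sum_mul, ← Nat.cast_sum, Nat.sum_range_choose, Nat.cast_pow,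
    Nat.cast_ofNat]
  gcongr
  exact one_le_two

theorem fieldCkNorm_lt_top (hT : 0 < T) {k : ℕ} (hV : ContDiffOn ℝ k V (fieldDomain D T univ))
    (r : ℝ) : fieldCkNorm k T r V < ⊤ := by
  obtain ⟨c, -, hc⟩ := exists_bound_iteratedFDerivWithin (uniqueDiffOn_fieldDomain hT) hV
    (isCompact_fieldDomain (isCompact_closedBall (0 : EuclideanSpace ℝ (Fin n)) r))
    (fieldDomain_mono (subset_univ _))
  exact (ckNorm_le_ofReal _ (norm_fieldBasis_le n D) hc).trans_lt ENNReal.ofReal_lt_top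

theorem norm_le_setRadius {K : Set (EuclideanSpace ℝ (Fin n))} (hK : IsCompact K)
    {x : EuclideanSpace ℝ (Fin n)} (hx : x ∈ K) : ‖x‖ ≤ setRadius K :=
  le_csSup (hK.image continuous_norm).bddAbove (mem_image_of_mem _ hx)

theorem segmentPoint_segmentCurve_mem (hX : IsCharacteristicFlow T V X) (hT : 0 < T) (hC : 0 < C)
    (hgrowth : LinearGrowth T C V) {R : ℝ} {p : FlowVar n D}
    (hp : p ∈ flowDomain D T (closedBall (0 : EuclideanSpace ℝ (Fin n)) R)) {σ : ℝ}
    (hσ : σ ∈ Icc (0 : ℝ) 1) : segmentPoint (σ, segmentCurve X (σ, p), p) ∈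
      fieldDomain D T (closedBall (0 : EuclideanSpace ℝ (Fin n)) (confiningRadius T C R)) := by
  refine ⟨segment_mem_Icc hp.1 hp.2.1 hσ, ?_, hp.2.2.2⟩
  have h1 := hX.norm_le hC hgrowth (segment_mem_Icc hp.1 hp.2.1 hσ) hp.2.1 p.2.2.1 hp.2.2.2
  have h2 := confiningRadius_mono hT hC (mem_closedBall_zero_iff.1 hp.2.2.1)
  simpa [segmentPoint, segmentCurve] using h1.trans h2

/-- Unlike the confining radius, this bound does not involve `C`, so it can size the compact set on
which uniform constants are chosen. -/
theorem norm_segmentCurve_le (hX : IsCharacteristicFlow T V X) (hT : 0 < T) {p : FlowVar n D}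
    (hp : p ∈ flowDomain D T univ) {M : ℝ}
    (hM : ∀ σ ∈ Icc (0 : ℝ) 1, ‖V (segmentPoint (σ, segmentCurve X (σ, p), p))‖ ≤ M)
    {σ : ℝ} (hσ : σ ∈ Icc (0 : ℝ) 1) : ‖segmentCurve X (σ, p)‖ ≤ T * M := by
  have hsol := hX.isParametricSolution p hp
  have hM0 : 0 ≤ M := (norm_nonneg _).trans (hM σ hσ)
  have h := norm_le_of_norm_deriv_le_mul_add (ε := T * M) le_rfl (by positivity) hsol.2
    (fun τ hτ => ?_) σ hσ
  · simpa [hsol.1] using h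
  · rw [zero_mul, zero_add, segmentField, norm_smul]
    refine mul_le_mul ?_ (hM τ hτ) (norm_nonneg _) hT.le
    simpa using abs_sub_le_of_le_of_le hp.1.1 hp.1.2 hp.2.1.1 hp.2.1.2

theorem norm_iteratedFDerivWithin_flow_le (hT : 0 < T) {k j : ℕ} (hj : j ≤ k)
    (hcurve : ContDiffOn ℝ k (fun p => segmentCurve X (1, p)) (flowDomain D T univ))
    {p : FlowVar n D} (hp : p ∈ flowDomain D T univ) :
    ‖iteratedFDerivWithin ℝ j X (flowDomain D T univ) p‖ ≤
      ‖iteratedFDerivWithin ℝ j (fun p : FlowVar n D => p.2.2.1) (flowDomain D T univ) p‖ +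
      ‖iteratedFDerivWithin ℝ j (fun p => segmentCurve X (1, p)) (flowDomain D T univ) p‖ := by
  have hjk : (j : WithTop ℕ∞) ≤ k := by exact_mod_cast hj
  have hx : ContDiff ℝ j fun p : FlowVar n D => p.2.2.1 := by fun_prop
  rw [iteratedFDerivWithin_congr
      (f₁ := X) (f := (fun p : FlowVar n D => p.2.2.1) + fun p => segmentCurve X (1, p))
      (fun p _ => eq_add_segmentCurve p) hp,
    iteratedFDerivWithin_add_apply hx.contDiffWithinAt ((hcurve p hp).of_le hjk)
      (uniqueDiffOn_flowDomain hT) hp]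
  exact norm_add_le _ _

theorem exists_bound_flowCkNorm (n D k : ℕ) (T R M : ℝ) :
    ∃ g : ℝ, 0 < T → 1 ≤ k → 0 ≤ M → ∀ (C : ℝ) (V : FieldVar n D → EuclideanSpace ℝ (Fin n))
      (X : FlowVar n D → EuclideanSpace ℝ (Fin n)) (K : Set (EuclideanSpace ℝ (Fin n))), 0 < C →
      ContDiffOn ℝ k V (fieldDomain D T univ) → LinearGrowth T C V → IsCharacteristicFlow T V X →
      IsCompact K → setRadius K = R →
      fieldCkNorm k T (confiningRadius T C R) V ≤ ENNReal.ofReal M →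
      flowCkNorm k T K X ≤ ENNReal.ofReal g := by
  by_cases hT : 0 < T
  swap
  · exact ⟨0, fun h => absurd h hT⟩
  obtain ⟨b, hb0, hb⟩ := exists_norm_iteratedFDerivWithin_le_of_ckNorm_le
    (F := EuclideanSpace ℝ (Fin n)) (fieldBasis n D) k
  -- `b * M` bounds the operator norms of the derivatives of `V` on the confining ball, hence `T *
  -- (b * M)` the displacements.
  obtain ⟨c, hc⟩ := exists_bound_iteratedFDerivWithin_segmentField n D k hT R (T * (b * M)) (b * M)
  have hQ := uniqueDiffOn_flowDomain (n := n) (D := D) hT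
  have hx : ContDiff ℝ k fun p : FlowVar n D => p.2.2.1 := by fun_prop
  obtain ⟨a, -, ha⟩ := exists_bound_iteratedFDerivWithin (k := k) hQ hx.contDiffOn
    (isCompact_flowDomain (isCompact_closedBall (0 : EuclideanSpace ℝ (Fin n)) R))
    (flowDomain_mono (subset_univ _))
  refine ⟨a + solutionBound k c, fun _ hk hM C V X K hC hV hgrowth hX hK hR hVM => ?_⟩
  refine ckNorm_le_ofReal _ (norm_flowBasis_le n D) fun j hj p hp => ?_
  have hV1 : ContDiffOn ℝ 1 V (fieldDomain D T univ) := hV.of_le (by exact_mod_cast hk)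
  have hbM := hb V _ _ M hM hVM
  obtain ⟨hreg, hbd⟩ := parametricSolution_regularity k convex_flowDomain hQ
    (contDiffOn_segmentField hV) (hX.continuousOn_segmentCurve hT hC hV1 hgrowth)
    hX.isParametricSolution 1 (by simp)
  have hpR : p ∈ flowDomain D T (closedBall (0 : EuclideanSpace ℝ (Fin n)) R) :=
    flowDomain_mono (fun x hx => by simpa [← hR] using norm_le_setRadius hK hx) hp
  have hpQ : p ∈ flowDomain D T (univ : Set (EuclideanSpace ℝ (Fin n))) :=
    flowDomain_mono (subset_univ _) hp
  refine (norm_iteratedFDerivWithin_flow_le hT hj hreg hpQ).trans (add_le_add (ha j hj p hpR) ?_)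
  refine hbd p hpQ c (fun σ hσ i hi => hc V hV _ ⟨hσ, ?_, hpR⟩
    (fun l hl => hbM l hl _ (segmentPoint_segmentCurve_mem hX hT hC hgrowth hpR hσ)) i hi) j hj
  refine mem_closedBall_zero_iff.2 (norm_segmentCurve_le hX hT hpQ (fun τ hτ => ?_) hσ)
  have h := hbM 0 (Nat.zero_le _) _ (segmentPoint_segmentCurve_mem hX hT hC hgrowth hpR hτ)
  rwa [norm_iteratedFDerivWithin_zero] at h

end Flow

theorem proposition3p4 :
    ∃ G : ℕ → ℕ → ℝ → ℝ → ℝ → ℝ,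
      (∀ (k d : ℕ) (T R M : ℝ), 0 < G k d T R M) ∧
      (∀ (k d : ℕ) (T R : ℝ), Monotone (G k d T R)) ∧
      ∀ (n D k : ℕ) (_ : 1 ≤ n) (_ : 1 ≤ D) (_ : 1 ≤ k) (T C : ℝ) (_ : 0 < T) (_ : 0 < C)
        (V : FieldVar n D → EuclideanSpace ℝ (Fin n))
        (_ : ContDiffOn ℝ k V (fieldDomain D T Set.univ)) (_ : LinearGrowth T C V),
        (∃ X : FlowVar n D → EuclideanSpace ℝ (Fin n), IsCharacteristicFlow T V X) ∧
        ∀ X : FlowVar n D → EuclideanSpace ℝ (Fin n), IsCharacteristicFlow T V X →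
          ContDiffOn ℝ k X (flowDomain D T Set.univ) ∧
          ∀ K : Set (EuclideanSpace ℝ (Fin n)), IsCompact K →
            fieldCkNorm k T (confiningRadius T C (setRadius K)) V < ⊤ ∧
            flowCkNorm k T K X ≤ ENNReal.ofReal
              (G k (2 + n + D) T (setRadius K)
                (fieldCkNorm k T (confiningRadius T C (setRadius K)) V).toReal) := by
  choose g hg using exists_bound_flowCkNorm
  -- Since `n, D ≤ d`, summing over all pairs removes the dependence on them beyond `d`. Rounding
  -- `M` up and summing over smaller integers gives monotonicity; the `1` gives positivity.
  refine ⟨fun k d T R M => 1 + ∑ n ∈ Finset.range (d + 1), ∑ D ∈ Finset.range (d + 1),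
    ∑ i ∈ Finset.range (⌈M⌉₊ + 1), |g n D k T R i|, fun k d T R M => by positivity,
    fun k d T R M M' h => ?_, ?_⟩
  · dsimp only
    gcongr
  · intro n D k _ _ hk T C hT hC V hV hgrowth
    refine ⟨exists_isCharacteristicFlow hT hC (hV.of_le (by exact_mod_cast hk)) hgrowth,
      fun X hX => ⟨hX.contDiffOn hT hC hk hV hgrowth, fun K hK => ?_⟩⟩
    have htop := fieldCkNorm_lt_top hT hV (confiningRadius T C (setRadius K))
    refine ⟨htop, ?_⟩
    set M := (fieldCkNorm k T (confiningRadius T C (setRadius K)) V).toReal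
    refine (hg n D k T (setRadius K) ⌈M⌉₊ hT hk (Nat.cast_nonneg _) C V X K hC hV hgrowth hX hK rfl
      ?_).trans (ENNReal.ofReal_le_ofReal ?_)
    · rw [← ENNReal.ofReal_toReal htop.ne]
      exact ENNReal.ofReal_le_ofReal (Nat.le_ceil M)
    · have h1 : |g n D k T (setRadius K) ⌈M⌉₊| ≤
          ∑ i ∈ Finset.range (⌈M⌉₊ + 1), |g n D k T (setRadius K) i| :=
        Finset.single_le_sum (f := fun i : ℕ => |g n D k T (setRadius K) i|)
          (fun _ _ => abs_nonneg _) (Finset.self_mem_range_succ _)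
      have h2 : ∑ i ∈ Finset.range (⌈M⌉₊ + 1), |g n D k T (setRadius K) i| ≤
          ∑ D ∈ Finset.range (2 + n + D + 1), ∑ i ∈ Finset.range (⌈M⌉₊ + 1),
            |g n D k T (setRadius K) i| :=
        Finset.single_le_sum (f := fun D => ∑ i ∈ Finset.range (⌈M⌉₊ + 1),
          |g n D k T (setRadius K) i|) (fun _ _ => by positivity)
          (Finset.mem_range.2 (by omega : D < 2 + n + D + 1))
      have h3 : ∑ D ∈ Finset.range (2 + n + D + 1), ∑ i ∈ Finset.range (⌈M⌉₊ + 1),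
            |g n D k T (setRadius K) i| ≤
          ∑ m ∈ Finset.range (2 + n + D + 1), ∑ e ∈ Finset.range (2 + n + D + 1),
            ∑ i ∈ Finset.range (⌈M⌉₊ + 1), |g m e k T (setRadius K) i| :=
        Finset.single_le_sum (f := fun m => ∑ D ∈ Finset.range (2 + n + D + 1),
          ∑ i ∈ Finset.range (⌈M⌉₊ + 1), |g m D k T (setRadius K) i|)
          (fun _ _ => by positivity) (Finset.mem_range.2 (by omega : n < 2 + n + D + 1))
      dsimp only
      linarith [le_abs_self (g n D k T (setRadius K) ⌈M⌉₊)]
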